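/- All graphs are simple, undirected and countable. Fix an integer $\Delta \ge 4$, and let $\mathbf{Gr}$ be the set of isomorphism classes $[X,x]$ of connected rooted graphs $(X,x)$ all of whose vertices have degree at most $\Delta$, with the metric $\rho([X,x],[Y,y]) = 2^{-r}$ for $[X,x] \ne [Y,y]$, where $r$ is the largest integer $s \geq 0$ such that the rooted balls $(B_X(x,s),x)$ and $(B_Y(y,s),y)$ are isomorphic; here $B_X(x,s)$ is the subgraph of $X$ induced by the vertices at graph distance at most $s$ from $x$. The law $\Psi(X)$ of a finite graph $X$ with degrees at most $\Delta$ is the Borel probability measure on $\mathbf{Gr}$ which gives mass $|\mathrm{Aut}(X)x|/|V(X)|$ to each class $[X_x,x]$, $x \in V(X)$, where $X_x$ is the connected component of $x$; that is, $\Psi(X)$ is the distribution of $[X_x,x]$ for a uniformly random vertex $x$. Weak convergence is convergence of the integrals of all bounded continuous functions $\mathbf{Gr} \to \mathbb{R}$. Let $T$ be the $3$-regular tree with a vertex $t$. Let $\Lambda$ be the infinite perfect binary tree, in which the first ancestor has degree $2$ and every vertex has two children. Let $\bar\Lambda$ be the barred binary tree, obtained from the infinite perfect binary tree by joining the two children of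 each vertex by an edge; $\bar\lambda$ is its first ancestor. Put $T_n = B_T(t,n)$ and $\bar\Lambda_n = B_{\bar\Lambda}(\bar\lambda,n)$. Let $(u_1,\ldots,u_n,t)$ be a path in $T_n$ from a leaf $u_1$ to $t$, and let $(\bar u_1,\ldots,\bar u_n,\bar\lambda)$ be a path in $\bar\Lambda_n$ that ascends, from child to parent, from a vertex $\bar u_1$ at distance $n$ from $\bar\lambda$ to $\bar\lambda$ (the choice does not matter up to isomorphism). Let $S$ be the tree with vertices $(h,m)$, $h,m \in \{0,1,2,\ldots\}$, in which $(h,m)$ is adjacent to its parent $(h+1,\lfloor m/2 \rfloor)$. Let $\bar S$ be obtained from $S$ by joining the two children $(h,2m)$ and $(h,2m+1)$ of each vertex $(h+1,m)$ by an edge. Let $u_i$ and $\bar u_i$ also denote the vertex $(i-1,0)$ of $S$ and of $\bar S$, respectively, and define the probability measures $$\mu_S = \sum_{i \ge 1} 2^{-i}\,\delta_{[S,u_i]}, \qquad \mu_{\bar S} = \sum_{i \ge 1} 2^{-i}\,\delta_{[\bar S,\bar u_i]}$$ on $\mathbf{Gr}$. Then, for every $i \ge 1$, one has $[S,u_i]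 = \lim_{n\to\infty} [T_n,u_i]$ and $[\bar S,\bar u_i] = \lim_{n\to\infty} [\bar\Lambda_n,\bar u_i]$ in $\mathbf{Gr}$. Let $X$ be the graph obtained from the disjoint union of $\Lambda$ and $\bar\Lambda$ by adding the edge $xy$, where $x$ is the first ancestor of $\Lambda$ and $y$ is the first ancestor of $\bar\Lambda$. Then, as $n \to \infty$, the laws $\Psi(B_X(x,n))$ converge weakly to $\frac23 \mu_S + \frac13 \mu_{\bar S}$, the laws $\Psi(B_X(y,n))$ converge weakly to $\frac13 \mu_S + \frac23 \mu_{\bar S}$, and these two limit measures are different. -/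

import Mathlib

open MeasureTheory Filter Topology
open scoped ENNReal

namespace AdjacentBalls

/-! ### Balls and bounded degree -/

/-- Every vertex of `X` has at most `Δ` neighbours. -/
def BoundedDegree (Δ : ℕ) {V : Type} (X : SimpleGraph V) : Prop :=
  ∀ v, (X.neighborSet v).encard ≤ Δ

/-- The vertices at graph distance at most `r` from `x` (the extended distance is infinite
between different connected components). -/
def ballSet {V : Type} (X : SimpleGraph V) (x : V) (r : ℕ) : Set V :=
  {y | X.edist x y ≤ r}

/-- The closed ball `B_X(x, r)`: the subgraph induced by the vertices at distance at most `r`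
from `x`. -/
abbrev ball {V : Type} (X : SimpleGraph V) (x : V) (r : ℕ) : SimpleGraph (ballSet X x r) :=
  X.induce (ballSet X x r)

theorem BoundedDegree.mono {Δ Δ' : ℕ} {V : Type} {X : SimpleGraph V} (h : BoundedDegree Δ X)
    (hle : Δ ≤ Δ') : BoundedDegree Δ' X :=
  fun v => (h v).trans (by exact_mod_cast hle)

theorem BoundedDegree.induce {Δ : ℕ} {V : Type} {X : SimpleGraph V} (h : BoundedDegree Δ X)
    (A : Set V) : BoundedDegree Δ (X.induce A) := by
  intro v
  refine le_trans ?_ (h v.1)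
  rw [← Subtype.val_injective.encard_image]
  refine Set.encard_le_encard ?_
  rintro _ ⟨w, hw, rfl⟩
  exact hw

theorem self_mem_ballSet {V : Type} (X : SimpleGraph V) (x : V) (r : ℕ) : x ∈ ballSet X x r := by
  simp [ballSet]

instance {V : Type} (X : SimpleGraph V) (x : V) (r : ℕ) : Nonempty (ballSet X x r) :=
  ⟨⟨x, self_mem_ballSet X x r⟩⟩

theorem ballSet_mono {V : Type} (X : SimpleGraph V) (x : V) {r s : ℕ} (h : r ≤ s) :
    ballSet X x r ⊆ ballSet X x s := by
  intro y hy
  have hy' : X.edist x y ≤ (r : ℕ∞) := hy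
  exact hy'.trans (by exact_mod_cast h)

theorem mem_ballSet_zero {V : Type} {X : SimpleGraph V} {x y : V} :
    y ∈ ballSet X x 0 ↔ y = x := by
  simp [ballSet, @eq_comm _ y x]

theorem mem_ballSet_succ {V : Type} {X : SimpleGraph V} {x y : V} {r : ℕ} :
    y ∈ ballSet X x (r + 1) ↔ y ∈ ballSet X x r ∨ ∃ z ∈ ballSet X x r, X.Adj z y := by
  constructor
  · intro h
    have hne : X.edist x y ≠ ⊤ := fun ht => by
      have h' : X.edist x y ≤ ((r + 1 : ℕ) : ℕ∞) := h
      rw [ht] at h'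
      simp at h'
    obtain ⟨p, hp⟩ := SimpleGraph.exists_walk_of_edist_ne_top hne
    have hlen : p.length ≤ r + 1 := by
      have h' : X.edist x y ≤ ((r + 1 : ℕ) : ℕ∞) := h
      rw [← hp] at h'
      exact_mod_cast h'
    by_cases hnil : p.Nil
    · left
      rw [hnil.eq]
      exact self_mem_ballSet X _ r
    · right
      refine ⟨p.penultimate, ?_, p.adj_penultimate hnil⟩
      refine (SimpleGraph.edist_le p.dropLast).trans ?_
      have : p.dropLast.length ≤ r := by
        simp
        omega
      exact_mod_cast this
  · rintro (h | ⟨z, hz, hadj⟩)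
    · exact ballSet_mono X x (Nat.le_succ r) h
    · refine (SimpleGraph.edist_triangle (v := z)).trans ?_
      have h1 : X.edist z y = 1 := SimpleGraph.edist_eq_one_iff_adj.2 hadj
      rw [h1]
      push_cast
      gcongr
      exact hz

theorem ball_connected {V : Type} (X : SimpleGraph V) (x : V) (r : ℕ) : (ball X x r).Connected := by
  rw [SimpleGraph.connected_iff_exists_forall_reachable]
  refine ⟨⟨x, self_mem_ballSet X x r⟩, ?_⟩
  suffices h : ∀ k, k ≤ r → ∀ y (hy : y ∈ ballSet X x k) (hy' : y ∈ ballSet X x r),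
      (ball X x r).Reachable ⟨x, self_mem_ballSet X x r⟩ ⟨y, hy'⟩ from
    fun y => h r le_rfl y.1 y.2 y.2
  intro k
  induction k with
  | zero =>
    intro _ y hy hy'
    obtain rfl := mem_ballSet_zero.1 hy
    exact SimpleGraph.Reachable.refl _
  | succ k ih =>
    intro hk y hy hy'
    rcases mem_ballSet_succ.1 hy with h | ⟨z, hz, hadj⟩
    · exact ih (by omega) y h hy'
    · have hz' := ballSet_mono X x (show k ≤ r by omega) hz
      refine (ih (by omega) z hz hz').trans (SimpleGraph.Adj.reachable ?_)
      exact hadj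

theorem BoundedDegree.finite_ballSet {Δ : ℕ} {V : Type} {X : SimpleGraph V}
    (h : BoundedDegree Δ X) (x : V) (r : ℕ) : (ballSet X x r).Finite := by
  induction r with
  | zero => exact (Set.finite_singleton x).subset fun y hy => mem_ballSet_zero.1 hy
  | succ r ih =>
    refine (ih.union (ih.biUnion fun z _ => ?_ : (⋃ z ∈ ballSet X x r, X.neighborSet z).Finite)).subset
      fun y hy => ?_
    · exact Set.finite_of_encard_le_coe (h z)
    · rcases mem_ballSet_succ.1 hy with h | ⟨z, hz, hadj⟩
      · exact Or.inl h
      · exact Or.inr (Set.mem_biUnion hz hadj)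

/-! ### Rooted graphs and the space `Gr` -/

/-- Countable connected rooted graphs all of whose vertices have degree at most `Δ`. -/
structure RootedGraph (Δ : ℕ) where
  V : Type
  countable : Countable V
  graph : SimpleGraph V
  root : V
  connected : graph.Connected
  bounded : BoundedDegree Δ graph

/-- Isomorphism of rooted graphs. -/
instance RootedGraph.setoid (Δ : ℕ) : Setoid (RootedGraph Δ) where
  r G H := ∃ φ : G.graph ≃g H.graph, φ G.root = H.root
  iseqv :=
    { refl := fun _ => ⟨SimpleGraph.Iso.refl, rfl⟩
      symm := by
        rintro G H ⟨φ, h⟩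
        exact ⟨φ.symm, by rw [← h]; exact φ.symm_apply_apply _⟩
      trans := by
        rintro G H K ⟨φ, h⟩ ⟨ψ, h'⟩
        exact ⟨φ.trans ψ, by rw [← h', ← h]; rfl⟩ }

/-- The set of isomorphism classes `[X, x]` of countable connected rooted graphs whose vertices
have degree at most `Δ`. -/
def Gr (Δ : ℕ) : Type 1 := Quotient (RootedGraph.setoid Δ)

/-- The rooted graph `(B_X(x, s), x)`. -/
def RootedGraph.ball {Δ : ℕ} (G : RootedGraph Δ) (s : ℕ) : RootedGraph Δ where
  V := ballSet G.graph G.root s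
  countable := haveI := G.countable; inferInstance
  graph := AdjacentBalls.ball G.graph G.root s
  root := ⟨G.root, self_mem_ballSet _ _ _⟩
  connected := ball_connected _ _ _
  bounded := G.bounded.induce _

theorem iso_maps_ballSet {Δ : ℕ} {G H : RootedGraph Δ} {s : ℕ}
    (φ : (G.ball s).graph ≃g (H.ball s).graph) (hφ : φ (G.ball s).root = (H.ball s).root)
    {r : ℕ} (hr : r ≤ s) (y : (G.ball s).V) (hy : y.1 ∈ ballSet G.graph G.root r) :
    (φ y).1 ∈ ballSet H.graph H.root r := by
  induction r generalizing y with
  | zero =>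
    have : y = (G.ball s).root := Subtype.ext (mem_ballSet_zero.1 hy)
    rw [this, hφ]
    exact self_mem_ballSet _ _ _
  | succ r ih =>
    rcases mem_ballSet_succ.1 hy with h | ⟨z, hz, hadj⟩
    · exact ballSet_mono _ _ (Nat.le_succ r) (ih (by omega) y h)
    · have hz' := ballSet_mono _ _ (show r ≤ s by omega) hz
      refine mem_ballSet_succ.2 (Or.inr ⟨_, ih (by omega) ⟨z, hz'⟩ hz, ?_⟩)
      have : (G.ball s).graph.Adj ⟨z, hz'⟩ y := hadj
      exact φ.map_adj_iff.2 this

theorem ball_equiv_of_le {Δ : ℕ} {G H : RootedGraph Δ} {r s : ℕ} (hr : r ≤ s)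
    (h : G.ball s ≈ H.ball s) : G.ball r ≈ H.ball r := by
  obtain ⟨φ, hφ⟩ := h
  have hφ' : φ.symm (H.ball s).root = (G.ball s).root := by
    rw [← hφ]; exact φ.symm_apply_apply _
  refine ⟨⟨⟨fun y => ⟨(φ ⟨y.1, ballSet_mono _ _ hr y.2⟩).1, iso_maps_ballSet φ hφ hr _ y.2⟩,
    fun y => ⟨(φ.symm ⟨y.1, ballSet_mono _ _ hr y.2⟩).1,
      iso_maps_ballSet (G := H) (H := G) φ.symm hφ' hr _ y.2⟩, ?_, ?_⟩, ?_⟩, ?_⟩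
  · intro y
    have h : φ.symm (φ ⟨y.1, ballSet_mono _ _ hr y.2⟩) = ⟨y.1, ballSet_mono _ _ hr y.2⟩ :=
      φ.symm_apply_apply _
    exact Subtype.ext (congrArg (fun z : ballSet G.graph G.root s => z.1) h)
  · intro y
    have h : φ (φ.symm ⟨y.1, ballSet_mono _ _ hr y.2⟩) = ⟨y.1, ballSet_mono _ _ hr y.2⟩ :=
      φ.apply_symm_apply _
    exact Subtype.ext (congrArg (fun z : ballSet H.graph H.root s => z.1) h)
  · intro a b
    exact φ.map_adj_iff (v := ⟨a.1, ballSet_mono _ _ hr a.2⟩) (w := ⟨b.1, ballSet_mono _ _ hr b.2⟩)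
  · exact Subtype.ext (congrArg (fun z : ballSet H.graph H.root s => z.1) hφ)

theorem equiv_of_forall_ball {Δ : ℕ} {G H : RootedGraph Δ} (h : ∀ s, G.ball s ≈ H.ball s) :
    G ≈ H := by
  choose φ hφ using h
  have hφ' : ∀ s, (φ s).symm (H.ball s).root = (G.ball s).root := fun s => by
    rw [← hφ s]; exact (φ s).symm_apply_apply _
  have exG : ∀ (K : RootedGraph Δ) (v : K.V), ∃ r, v ∈ ballSet K.graph K.root r := fun K v => by
    obtain ⟨p⟩ := K.connected K.root v
    exact ⟨p.length, SimpleGraph.edist_le p⟩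
  have evG : ∀ (K : RootedGraph Δ) (v : K.V),
      ∀ᶠ s in (hyperfilter ℕ : Filter ℕ), v ∈ ballSet K.graph K.root s := fun K v => by
    obtain ⟨r, hr⟩ := exG K v
    refine ((eventually_ge_atTop r).filter_mono Nat.hyperfilter_le_atTop).mono fun s hs => ?_
    exact ballSet_mono _ _ hs hr
  have key : ∀ v : G.V, ∃ w : H.V, ∀ᶠ s in (hyperfilter ℕ : Filter ℕ),
      ∃ hv : v ∈ ballSet G.graph G.root s, (φ s ⟨v, hv⟩).1 = w := fun v => by
    obtain ⟨r, hr⟩ := exG G v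
    have : ∀ᶠ s in (hyperfilter ℕ : Filter ℕ), ∃ w ∈ ballSet H.graph H.root r,
        ∃ hv : v ∈ ballSet G.graph G.root s, (φ s ⟨v, hv⟩).1 = w := by
      refine ((eventually_ge_atTop r).filter_mono Nat.hyperfilter_le_atTop).mono fun s hs => ?_
      exact ⟨_, iso_maps_ballSet (φ s) (hφ s) hs ⟨v, ballSet_mono _ _ hs hr⟩ hr, _, rfl⟩
    obtain ⟨w, -, hw⟩ := (Ultrafilter.eventually_exists_mem_iff
      (H.bounded.finite_ballSet H.root r)).1 this
    exact ⟨w, hw⟩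
  have key' : ∀ w : H.V, ∃ v : G.V, ∀ᶠ s in (hyperfilter ℕ : Filter ℕ),
      ∃ hw : w ∈ ballSet H.graph H.root s, ((φ s).symm ⟨w, hw⟩).1 = v := fun w => by
    obtain ⟨r, hr⟩ := exG H w
    have : ∀ᶠ s in (hyperfilter ℕ : Filter ℕ), ∃ v ∈ ballSet G.graph G.root r,
        ∃ hw : w ∈ ballSet H.graph H.root s, ((φ s).symm ⟨w, hw⟩).1 = v := by
      refine ((eventually_ge_atTop r).filter_mono Nat.hyperfilter_le_atTop).mono fun s hs => ?_
      exact ⟨_, iso_maps_ballSet (G := H) (H := G) (φ s).symm (hφ' s) hs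
        ⟨w, ballSet_mono _ _ hs hr⟩ hr, _, rfl⟩
    obtain ⟨v, -, hv⟩ := (Ultrafilter.eventually_exists_mem_iff
      (G.bounded.finite_ballSet G.root r)).1 this
    exact ⟨v, hv⟩
  choose f hf using key
  choose g hg using key'
  refine ⟨⟨⟨f, g, ?_, ?_⟩, ?_⟩, ?_⟩
  · intro v
    obtain ⟨s, ⟨h1, h2⟩, h3, h4⟩ := ((hf v).and (hg (f v))).exists
    have : (⟨f v, h3⟩ : ballSet H.graph H.root s) = φ s ⟨v, h1⟩ := Subtype.ext h2.symm
    rw [← h4, this]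
    exact congrArg Subtype.val ((φ s).symm_apply_apply ⟨v, h1⟩)
  · intro w
    obtain ⟨s, ⟨h1, h2⟩, h3, h4⟩ := ((hg w).and (hf (g w))).exists
    have : (⟨g w, h3⟩ : ballSet G.graph G.root s) = (φ s).symm ⟨w, h1⟩ := Subtype.ext h2.symm
    rw [← h4, this]
    exact congrArg Subtype.val ((φ s).apply_symm_apply ⟨w, h1⟩)
  · intro a b
    obtain ⟨s, ⟨h1, h2⟩, h3, h4⟩ := ((hf a).and (hf b)).exists
    change H.graph.Adj (f a) (f b) ↔ G.graph.Adj a b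
    rw [← h2, ← h4]
    exact (φ s).map_adj_iff (v := ⟨a, h1⟩) (w := ⟨b, h3⟩)
  · obtain ⟨s, h1, h2⟩ := (hf G.root).exists
    change f G.root = H.root
    rw [← h2]
    exact congrArg Subtype.val (hφ s)

/-- The class of the rooted ball `[B_X(x, s), x]`, as a function of `[X, x]`. -/
def Gr.ball {Δ : ℕ} (g : Gr Δ) (s : ℕ) : Gr Δ :=
  Quotient.map (fun G : RootedGraph Δ => G.ball s) (by
    rintro G H ⟨φ, hφ⟩
    have aux : ∀ (G H : RootedGraph Δ) (φ : G.graph ≃g H.graph), φ G.root = H.root → ∀ r y,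
        y ∈ ballSet G.graph G.root r → φ y ∈ ballSet H.graph H.root r := by
      intro G H φ hφ r
      induction r with
      | zero =>
        intro y hy
        rw [mem_ballSet_zero.1 hy, hφ]
        exact self_mem_ballSet _ _ _
      | succ r ih =>
        intro y hy
        rcases mem_ballSet_succ.1 hy with h | ⟨z, hz, hadj⟩
        · exact ballSet_mono _ _ (Nat.le_succ r) (ih y h)
        · exact mem_ballSet_succ.2 (Or.inr ⟨_, ih z hz, φ.map_adj_iff.2 hadj⟩)
    have hφ' : φ.symm H.root = G.root := by rw [← hφ]; exact φ.symm_apply_apply _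
    refine ⟨⟨⟨fun y => ⟨φ y.1, aux G H φ hφ s _ y.2⟩,
      fun y => ⟨φ.symm y.1, aux H G φ.symm hφ' s _ y.2⟩, ?_, ?_⟩, ?_⟩, ?_⟩
    · intro y
      exact Subtype.ext (φ.symm_apply_apply y.1)
    · intro y
      exact Subtype.ext (φ.apply_symm_apply y.1)
    · intro a b
      exact φ.map_adj_iff (v := a.1) (w := b.1)
    · exact Subtype.ext hφ) g

theorem Gr.ball_eq_of_le {Δ : ℕ} {g h : Gr Δ} {r s : ℕ} (hr : r ≤ s) (hs : g.ball s = h.ball s) :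
    g.ball r = h.ball r := by
  induction g using Quotient.inductionOn with | _ G => ?_
  induction h using Quotient.inductionOn with | _ H => ?_
  exact Quotient.sound (ball_equiv_of_le hr (Quotient.exact hs))

theorem Gr.eq_of_forall_ball {Δ : ℕ} {g h : Gr Δ} (hs : ∀ s, g.ball s = h.ball s) : g = h := by
  induction g using Quotient.inductionOn with | _ G => ?_
  induction h using Quotient.inductionOn with | _ H => ?_
  exact Quotient.sound (equiv_of_forall_ball fun s => Quotient.exact (hs s))

theorem Gr.ball_zero {Δ : ℕ} (g h : Gr Δ) : g.ball 0 = h.ball 0 := by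
  induction g using Quotient.inductionOn with | _ G => ?_
  induction h using Quotient.inductionOn with | _ H => ?_
  have key : ∀ (K : RootedGraph Δ) (a : (K.ball 0).V), a = (K.ball 0).root :=
    fun K a => Subtype.ext (mem_ballSet_zero.1 a.2)
  refine Quotient.sound ⟨⟨⟨fun _ => (H.ball 0).root, fun _ => (G.ball 0).root,
    fun a => (key G a).symm, fun a => (key H a).symm⟩, ?_⟩, rfl⟩
  intro a b
  rw [key G a, key G b]
  simp

theorem Gr.bddAbove {Δ : ℕ} {g h : Gr Δ} (hne : g ≠ h) :
    BddAbove {s : ℕ | g.ball s = h.ball s} := by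
  by_contra hb
  refine hne (Gr.eq_of_forall_ball fun s => ?_)
  rw [not_bddAbove_iff] at hb
  obtain ⟨t, ht, hst⟩ := hb s
  exact Gr.ball_eq_of_le hst.le ht

open Classical in
/-- The distance `ρ` on `Gr`: it is `0` on the diagonal, and otherwise `2 ^ (-r)` with `r` the
largest `s` such that the rooted balls of radius `s` are isomorphic. -/
noncomputable def Gr.rho {Δ : ℕ} (g h : Gr Δ) : ℝ :=
  if g = h then 0 else (2⁻¹ : ℝ) ^ sSup {s : ℕ | g.ball s = h.ball s}

theorem Gr.rho_triangle {Δ : ℕ} (g h k : Gr Δ) : g.rho k ≤ max (g.rho h) (h.rho k) := by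
  by_cases h1 : g = h
  · subst h1; exact le_max_right _ _
  by_cases h2 : h = k
  · subst h2; exact le_max_left _ _
  by_cases h3 : g = k
  · subst h3
    simp only [Gr.rho, if_true]
    exact le_max_of_le_left (by split_ifs <;> positivity)
  simp only [Gr.rho, h1, h2, h3, if_false]
  have m1 := Nat.sSup_mem ⟨0, Gr.ball_zero g h⟩ (Gr.bddAbove h1)
  have m2 := Nat.sSup_mem ⟨0, Gr.ball_zero h k⟩ (Gr.bddAbove h2)
  set a := sSup {s : ℕ | g.ball s = h.ball s}
  set b := sSup {s : ℕ | h.ball s = k.ball s}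
  have m3 : min a b ≤ sSup {s : ℕ | g.ball s = k.ball s} :=
    le_csSup (Gr.bddAbove h3)
      ((Gr.ball_eq_of_le (min_le_left a b) m1).trans (Gr.ball_eq_of_le (min_le_right a b) m2))
  have anti : ∀ {m n : ℕ}, m ≤ n → (2⁻¹ : ℝ) ^ n ≤ 2⁻¹ ^ m := fun hmn =>
    pow_le_pow_of_le_one (by norm_num) (by norm_num) hmn
  rcases le_total a b with hab | hab
  · rw [min_eq_left hab] at m3
    exact le_max_of_le_left (anti m3)
  · rw [min_eq_right hab] at m3
    exact le_max_of_le_right (anti m3)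

theorem Gr.rho_nonneg {Δ : ℕ} (g h : Gr Δ) : 0 ≤ g.rho h := by
  unfold Gr.rho; split_ifs <;> positivity

noncomputable instance Gr.metricSpace (Δ : ℕ) : MetricSpace (Gr Δ) where
  dist := Gr.rho
  dist_self g := by simp [Gr.rho]
  dist_comm g h := by
    unfold Gr.rho
    rw [show {s : ℕ | g.ball s = h.ball s} = {s | h.ball s = g.ball s} from
      Set.ext fun s => eq_comm]
    by_cases hgh : g = h
    · rw [if_pos hgh, if_pos hgh.symm]
    · rw [if_neg hgh, if_neg (Ne.symm hgh)]
  dist_triangle g h k := (Gr.rho_triangle g h k).trans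
    (max_le_add_of_nonneg (Gr.rho_nonneg _ _) (Gr.rho_nonneg _ _))
  eq_of_dist_eq_zero := by
    intro g h hgh
    by_contra hne
    have : Gr.rho g h = 0 := hgh
    rw [Gr.rho, if_neg hne] at this
    exact absurd this (by positivity)

noncomputable instance Gr.measurableSpace (Δ : ℕ) : MeasurableSpace (Gr Δ) := borel _

instance Gr.borelSpace (Δ : ℕ) : BorelSpace (Gr Δ) := ⟨rfl⟩

/-! ### Rooted connected components and the law of a finite graph -/

theorem component_connected {V : Type} (X : SimpleGraph V) (x : V) :
    (X.induce {y | X.Reachable x y}).Connected := by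
  rw [SimpleGraph.connected_iff_exists_forall_reachable]
  refine ⟨⟨x, .refl x⟩, ?_⟩
  rintro ⟨y, ⟨p⟩⟩
  classical
  exact ⟨p.induce {y | X.Reachable x y} fun z hz => ⟨p.takeUntil z hz⟩⟩

/-- The rooted connected component `[X_x, x]` of a countable graph `X` with degrees at most `Δ`;
it is `[X, x]` when `X` is connected. -/
def component {Δ : ℕ} {V : Type} [Countable V] (X : SimpleGraph V) (hX : BoundedDegree Δ X)
    (x : V) : Gr Δ :=
  Quotient.mk _
    { V := {y | X.Reachable x y}
      countable := inferInstance
      graph := X.induce {y | X.Reachable x y}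
      root := ⟨x, .refl x⟩
      connected := component_connected X x
      bounded := hX.induce _ }

/-- The law `Ψ(X)` of a finite graph `X`, i.e. the law of `[X_x, x]` for a uniformly chosen
vertex `x`. -/
noncomputable def law {Δ : ℕ} {V : Type} [Finite V] [Nonempty V] (X : SimpleGraph V)
    (hX : BoundedDegree Δ X) : ProbabilityMeasure (Gr Δ) :=
  ⟨(Nat.card V : ℝ≥0∞)⁻¹ • Measure.sum fun x : V => Measure.dirac (component X hX x), ⟨by
    have := Fintype.ofFinite V
    rw [Measure.smul_apply, Measure.sum_apply _ MeasurableSet.univ]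
    simp only [measure_univ, smul_eq_mul, ENNReal.tsum_const, ENat.card_eq_coe_natCard, mul_one]
    refine ENNReal.inv_mul_cancel ?_ (by simp)
    simp⟩⟩

open Classical in
/-- Extension of an isomorphism between two connected components to the whole vertex set. -/
noncomputable def swapComponents {V : Type} (X : SimpleGraph V) (x y : V)
    (e : X.induce {z | X.Reachable x z} ≃g X.induce {z | X.Reachable y z}) (z : V) : V :=
  if h : X.Reachable x z then (e ⟨z, h⟩).1
  else if h' : X.Reachable y z then (e.symm ⟨z, h'⟩).1 else z

theorem swapComponents_inv {V : Type} (X : SimpleGraph V) (x y : V)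
    (e : X.induce {z | X.Reachable x z} ≃g X.induce {z | X.Reachable y z}) (z : V) :
    swapComponents X y x e.symm (swapComponents X x y e z) = z := by
  by_cases h : X.Reachable x z
  · have h1 : swapComponents X x y e z = (e ⟨z, h⟩).1 := dif_pos h
    have h2 : X.Reachable y (e ⟨z, h⟩).1 := (e ⟨z, h⟩).2
    rw [h1, swapComponents, dif_pos h2]
    exact congrArg Subtype.val (e.symm_apply_apply ⟨z, h⟩)
  · by_cases h' : X.Reachable y z
    · have h1 : swapComponents X x y e z = (e.symm ⟨z, h'⟩).1 := by
        rw [swapComponents, dif_neg h, dif_pos h']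
      have h2 : X.Reachable x (e.symm ⟨z, h'⟩).1 := (e.symm ⟨z, h'⟩).2
      have h3 : ¬ X.Reachable y (e.symm ⟨z, h'⟩).1 := fun h3 => h (h2.trans (h3.symm.trans h'))
      rw [h1, swapComponents, dif_neg h3, dif_pos h2]
      exact congrArg Subtype.val (e.apply_symm_apply ⟨z, h'⟩)
    · have h1 : swapComponents X x y e z = z := by
        rw [swapComponents, dif_neg h, dif_neg h']
      rw [h1, swapComponents, dif_neg h', dif_neg h]

theorem swapComponents_adj {V : Type} (X : SimpleGraph V) (x y : V)
    (e : X.induce {z | X.Reachable x z} ≃g X.induce {z | X.Reachable y z}) {a b : V}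
    (hab : X.Adj a b) : X.Adj (swapComponents X x y e a) (swapComponents X x y e b) := by
  by_cases h : X.Reachable x a
  · have h' : X.Reachable x b := h.trans hab.reachable
    rw [swapComponents, swapComponents, dif_pos h, dif_pos h']
    exact e.map_adj_iff (v := ⟨a, h⟩) (w := ⟨b, h'⟩) |>.2 hab
  · have h' : ¬ X.Reachable x b := fun h' => h (h'.trans hab.symm.reachable)
    by_cases k : X.Reachable y a
    · have k' : X.Reachable y b := k.trans hab.reachable
      rw [swapComponents, swapComponents, dif_neg h, dif_neg h', dif_pos k, dif_pos k']
      exact e.symm.map_adj_iff (v := ⟨a, k⟩) (w := ⟨b, k'⟩) |>.2 hab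
    · have k' : ¬ X.Reachable y b := fun k' => k (k'.trans hab.symm.reachable)
      rwa [swapComponents, swapComponents, dif_neg h, dif_neg h', dif_neg k, dif_neg k']

theorem component_eq_iff {Δ : ℕ} {V : Type} [Countable V] (X : SimpleGraph V)
    (hX : BoundedDegree Δ X) (x y : V) :
    component X hX x = component X hX y ↔ ∃ φ : X ≃g X, φ x = y := by
  constructor
  · intro h
    obtain ⟨e, he⟩ : ∃ e : X.induce {z | X.Reachable x z} ≃g X.induce {z | X.Reachable y z},
      e ⟨x, .refl x⟩ = ⟨y, .refl y⟩ := Quotient.exact h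
    refine ⟨⟨⟨swapComponents X x y e, swapComponents X y x e.symm, swapComponents_inv X x y e,
      swapComponents_inv X y x e.symm⟩, ?_⟩, ?_⟩
    · intro a b
      refine ⟨fun hab => ?_, fun hab => swapComponents_adj X x y e hab⟩
      have := swapComponents_adj X y x e.symm hab
      change X.Adj (swapComponents X y x e.symm (swapComponents X x y e a))
        (swapComponents X y x e.symm (swapComponents X x y e b)) at this
      rwa [swapComponents_inv, swapComponents_inv] at this
    · change swapComponents X x y e x = y
      rw [swapComponents, dif_pos (SimpleGraph.Reachable.refl x), he]
  · rintro ⟨φ, rfl⟩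
    have h1 : ∀ z, X.Reachable x z → X.Reachable (φ x) (φ z) := fun z hz => φ.reachable_iff.2 hz
    have h2 : ∀ z, X.Reachable (φ x) z → X.Reachable x (φ.symm z) := fun z hz => by
      rw [← φ.reachable_iff, φ.apply_symm_apply]; exact hz
    refine Quotient.sound ⟨⟨⟨fun z => ⟨φ z.1, h1 _ z.2⟩, fun z => ⟨φ.symm z.1, h2 _ z.2⟩,
      fun z => Subtype.ext (φ.symm_apply_apply z.1),
      fun z => Subtype.ext (φ.apply_symm_apply z.1)⟩, ?_⟩, rfl⟩
    intro a b
    exact φ.map_adj_iff (v := a.1) (w := b.1)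

/-- The law of `X` gives the class `[X_x, x]` the mass `|Aut(X) x| / |V(X)|`. -/
theorem law_apply_singleton {Δ : ℕ} {V : Type} [Finite V] [Nonempty V] (X : SimpleGraph V)
    (hX : BoundedDegree Δ X) (x : V) :
    (law X hX : Measure (Gr Δ)) {component X hX x} =
      ({y | ∃ φ : X ≃g X, φ x = y}.ncard : ℝ≥0∞) / (Nat.card V : ℝ≥0∞) := by
  classical
  have := Fintype.ofFinite V
  change ((Nat.card V : ℝ≥0∞)⁻¹ • Measure.sum fun x : V => Measure.dirac (component X hX x)) _ = _
  rw [Measure.smul_apply, Measure.sum_apply _ (measurableSet_singleton _), tsum_fintype,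
    div_eq_mul_inv, mul_comm, smul_eq_mul]
  congr 1
  have h : ∀ y, Measure.dirac (component X hX y) {component X hX x} =
      if y ∈ {y | ∃ φ : X ≃g X, φ x = y} then (1 : ℝ≥0∞) else 0 := fun y => by
    rw [Measure.dirac_apply' _ (measurableSet_singleton _), Set.indicator_apply]
    simp only [Set.mem_singleton_iff, Pi.one_apply, Set.mem_ofPred_eq, ← component_eq_iff X hX,
      @eq_comm _ (component X hX y)]
  rw [Finset.sum_congr rfl fun y _ => h y, Finset.sum_ite, Set.ncard_eq_toFinset_card']
  simp

/-- The law of the ball `B_X(x, n)`, which is finite since the degrees are bounded. -/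
noncomputable def ballLaw {Δ : ℕ} {V : Type} (X : SimpleGraph V) (hX : BoundedDegree Δ X)
    (x : V) (n : ℕ) : ProbabilityMeasure (Gr Δ) :=
  haveI : Finite (ballSet X x n) := hX.finite_ballSet x n
  law (ball X x n) (hX.induce _)

/-! ### The graphs -/

/-- The infinite perfect binary tree: the vertices are the finite binary words, the children of
`w` are `true :: w` and `false :: w`, and the first ancestor is the empty word. -/
def binaryTree : SimpleGraph (List Bool) :=
  SimpleGraph.fromRel fun u v => ∃ b, v = b :: u

/-- The barred binary tree: the perfect binary tree with an additional edge (a bar) between the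
two children of every vertex. -/
def barredTree : SimpleGraph (List Bool) :=
  SimpleGraph.fromRel fun u v => (∃ b, v = b :: u) ∨ ∃ b w, u = b :: w ∧ v = (!b) :: w

/-- The graph obtained from the disjoint union of `X` and `Y` by adding the edge between the
vertex `a` of `X` and the vertex `b` of `Y`. -/
def join {V W : Type} (X : SimpleGraph V) (a : V) (Y : SimpleGraph W) (b : W) :
    SimpleGraph (V ⊕ W) :=
  (X ⊕g Y) ⊔ SimpleGraph.edge (Sum.inl a) (Sum.inr b)

/-- The 3-regular tree: two perfect binary trees with an edge between their first ancestors. -/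
def regularTree : SimpleGraph (List Bool ⊕ List Bool) := join binaryTree [] binaryTree []

/-- The perfect binary tree and the barred binary tree with an edge between their first
ancestors. -/
def joinedTree : SimpleGraph (List Bool ⊕ List Bool) := join binaryTree [] barredTree []

/-- The graph `S`: the vertex `(h, m)` is the `m`-th vertex at height `h`, its parent is
`(h + 1, ⌊m / 2⌋)`, so that the vertices `(0, m)` are the leaves and every vertex `(h + 1, m)` has
the two children `(h, 2 m)` and `(h, 2 m + 1)`. -/
def graphS : SimpleGraph (ℕ × ℕ) :=
  SimpleGraph.fromRel fun p q => q = (p.1 + 1, p.2 / 2)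

/-- The graph `S̄`: the graph `S` with an additional edge between the two children of every
vertex of positive height. -/
def graphSBar : SimpleGraph (ℕ × ℕ) :=
  SimpleGraph.fromRel fun p q => q = (p.1 + 1, p.2 / 2) ∨ (p.1 = q.1 ∧ p.2 / 2 = q.2 / 2)

theorem encard_le_of_subset_finset {V : Type} {s : Set V} (F : Finset V) {k : ℕ} (h : s ⊆ F)
    (hF : F.card ≤ k) : s.encard ≤ k := by
  refine (Set.encard_le_encard h).trans ?_
  rw [Set.encard_coe_eq_coe_finsetCard]
  exact_mod_cast hF

theorem barredTree_neighborSet_nil :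
    barredTree.neighborSet [] ⊆ (({[true], [false]} : Finset (List Bool)) : Set (List Bool)) := by
  intro u hu
  simp only [SimpleGraph.mem_neighborSet, barredTree, SimpleGraph.fromRel_adj] at hu
  obtain ⟨-, (⟨b, rfl⟩ | ⟨b, w, h, -⟩) | ⟨b, h⟩ | ⟨b, w, rfl, h⟩⟩ := hu
  · cases b <;> simp
  · simp at h
  · simp at h
  · simp at h

theorem barredTree_neighborSet_cons (c : Bool) (v : List Bool) :
    barredTree.neighborSet (c :: v) ⊆
      (({v, (!c) :: v, true :: c :: v, false :: c :: v} : Finset (List Bool)) :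
        Set (List Bool)) := by
  intro u hu
  simp only [SimpleGraph.mem_neighborSet, barredTree, SimpleGraph.fromRel_adj] at hu
  obtain ⟨-, (⟨b, rfl⟩ | ⟨b, w, h, rfl⟩) | ⟨b, h⟩ | ⟨b, w, rfl, h⟩⟩ := hu
  · cases b <;> simp
  · simp only [List.cons.injEq] at h
    obtain ⟨rfl, rfl⟩ := h
    simp
  · simp only [List.cons.injEq] at h
    obtain ⟨rfl, rfl⟩ := h
    simp
  · simp only [List.cons.injEq] at h
    obtain ⟨rfl, rfl⟩ := h
    simp

theorem binaryTree_le_barredTree : binaryTree ≤ barredTree := by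
  intro u v h
  simp only [binaryTree, barredTree, SimpleGraph.fromRel_adj] at h ⊢
  tauto

theorem BoundedDegree.anti {Δ : ℕ} {V : Type} {X Y : SimpleGraph V} (hY : BoundedDegree Δ Y)
    (h : X ≤ Y) : BoundedDegree Δ X :=
  fun v => (Set.encard_le_encard fun _ hw => h hw).trans (hY v)

theorem barredTree_bounded : BoundedDegree 4 barredTree := by
  rintro (_ | ⟨c, v⟩)
  · exact encard_le_of_subset_finset _ barredTree_neighborSet_nil
      (Finset.card_le_two.trans (by norm_num))
  · exact encard_le_of_subset_finset _ (barredTree_neighborSet_cons c v) Finset.card_le_four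

theorem join_mono {V W : Type} {X X' : SimpleGraph V} {Y Y' : SimpleGraph W} (hX : X ≤ X')
    (hY : Y ≤ Y') (a : V) (b : W) : join X a Y b ≤ join X' a Y' b := by
  refine sup_le_sup_right ?_ _
  rintro (u | u) (v | v) h
  · exact hX h
  · exact h
  · exact h
  · exact hY h

theorem joinBarred_bounded : BoundedDegree 4 (join barredTree [] barredTree []) := by
  have h0 : ∀ u v : List Bool,
      (join barredTree [] barredTree []).Adj (.inl u) (.inl v) → barredTree.Adj u v := by
    intro u v h
    simpa [join, SimpleGraph.edge_adj] using h
  have h1 : ∀ u v : List Bool,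
      (join barredTree [] barredTree []).Adj (.inr u) (.inr v) → barredTree.Adj u v := by
    intro u v h
    simpa [join, SimpleGraph.edge_adj] using h
  have h2 : ∀ u v : List Bool,
      (join barredTree [] barredTree []).Adj (.inl u) (.inr v) → u = [] ∧ v = [] := by
    intro u v h
    simpa [join, SimpleGraph.edge_adj] using h
  rintro ((_ | ⟨c, v⟩) | (_ | ⟨c, v⟩))
  · refine encard_le_of_subset_finset {.inl [true], .inl [false], .inr []} ?_
      (Finset.card_le_three.trans (by norm_num))
    rintro (u | u) hu
    · simpa using barredTree_neighborSet_nil (h0 _ _ hu)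
    · simp [(h2 _ _ hu).2]
  · refine encard_le_of_subset_finset
      {.inl v, .inl ((!c) :: v), .inl (true :: c :: v), .inl (false :: c :: v)} ?_
      Finset.card_le_four
    rintro (u | u) hu
    · simpa using barredTree_neighborSet_cons c v (h0 _ _ hu)
    · simpa using (h2 _ _ hu).1
  · refine encard_le_of_subset_finset {.inr [true], .inr [false], .inl []} ?_
      (Finset.card_le_three.trans (by norm_num))
    rintro (u | u) hu
    · simp [(h2 _ _ hu.symm).1]
    · simpa using barredTree_neighborSet_nil (h1 _ _ hu)
  · refine encard_le_of_subset_finset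
      {.inr v, .inr ((!c) :: v), .inr (true :: c :: v), .inr (false :: c :: v)} ?_
      Finset.card_le_four
    rintro (u | u) hu
    · simpa using (h2 _ _ hu.symm).2
    · simpa using barredTree_neighborSet_cons c v (h1 _ _ hu)

theorem regularTree_bounded : BoundedDegree 4 regularTree :=
  joinBarred_bounded.anti (join_mono binaryTree_le_barredTree binaryTree_le_barredTree _ _)

theorem joinedTree_bounded : BoundedDegree 4 joinedTree :=
  joinBarred_bounded.anti (join_mono binaryTree_le_barredTree le_rfl _ _)

theorem graphSBar_bounded : BoundedDegree 4 graphSBar := by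
  rintro ⟨h, m⟩
  refine encard_le_of_subset_finset
    {(h + 1, m / 2), (h, if m % 2 = 0 then m + 1 else m - 1), (h - 1, 2 * m), (h - 1, 2 * m + 1)}
    ?_ Finset.card_le_four
  rintro ⟨k, l⟩ hu
  simp only [SimpleGraph.mem_neighborSet, graphSBar, SimpleGraph.fromRel_adj, ne_eq,
    Prod.mk.injEq] at hu
  simp only [Finset.coe_insert, Finset.coe_singleton, Set.mem_insert_iff, Prod.mk.injEq,
    Set.mem_singleton_iff]
  split_ifs <;> omega

theorem graphS_bounded : BoundedDegree 4 graphS := by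
  refine graphSBar_bounded.anti fun p q h => ?_
  simp only [graphS, graphSBar, SimpleGraph.fromRel_adj] at h ⊢
  tauto

/-! ### The measures `μ_S` and `μ_{S̄}` -/

/-- The vertex at distance `k` from the first ancestor on a fixed infinite path that descends from
the first ancestor of the perfect (or barred) binary tree. -/
def ray (k : ℕ) : List Bool := List.replicate k false

theorem ray_mem_ballSet {V : Type} (X : SimpleGraph V) (f : List Bool → V)
    (hf : ∀ u v, binaryTree.Adj u v → X.Adj (f u) (f v)) {k n : ℕ} (hk : k ≤ n) :
    f (ray k) ∈ ballSet X (f []) n := by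
  induction n generalizing k with
  | zero =>
    obtain rfl : k = 0 := by omega
    exact self_mem_ballSet X _ _
  | succ n ih =>
    rcases k with _ | k
    · exact self_mem_ballSet X _ _
    · refine mem_ballSet_succ.2 (Or.inr ⟨_, ih (k := k) (by omega), hf _ _ ?_⟩)
      simp [binaryTree, ray, List.replicate_succ]

/-- The probability measure which gives mass `2 ^ (-i)` to the `i`-th point of a sequence, for
`i = 1, 2, …`; the sequence is indexed from `0` here. -/
noncomputable def geometricLaw {Δ : ℕ} (g : ℕ → Gr Δ) : ProbabilityMeasure (Gr Δ) :=
  ⟨Measure.sum fun j : ℕ => ((2 : ℝ≥0∞)⁻¹ ^ (j + 1)) • Measure.dirac (g j), ⟨by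
    rw [Measure.sum_apply _ MeasurableSet.univ]
    simp only [Measure.smul_apply, measure_univ, smul_eq_mul, mul_one]
    rw [ENNReal.tsum_geometric_add_one, ENNReal.one_sub_inv_two, inv_inv]
    exact ENNReal.inv_mul_cancel (by norm_num) (by norm_num)⟩⟩

/-- The class `[T_n, u_{j + 1}]`, where `T_n` is the ball of radius `n` around the vertex
`t = Sum.inl []` of the 3-regular tree, `(u_1, …, u_n, t)` is a path of `T_n` which starts at a
leaf, and `j < n`. (The vertex `u_{j + 1}` is at distance `n - j` from `t`.) -/
def classT {Δ : ℕ} (hΔ : 4 ≤ Δ) (n j : ℕ) : Gr Δ :=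
  component (ball regularTree (Sum.inl []) n) ((regularTree_bounded.mono hΔ).induce _)
    ⟨Sum.inl (ray (n - j)), ray_mem_ballSet regularTree Sum.inl
      (fun _ _ h => Or.inl h) (Nat.sub_le n j)⟩

/-- The class `[Λ̄_n, ū_{j + 1}]`, where `Λ̄_n` is the ball of radius `n` around the first ancestor
of the barred binary tree, `(ū_1, …, ū_n, [])` is a path of `Λ̄_n` which starts at the lowest
level and ascends, and `j < n`. -/
def classBarred {Δ : ℕ} (hΔ : 4 ≤ Δ) (n j : ℕ) : Gr Δ :=
  component (ball barredTree [] n) ((barredTree_bounded.mono hΔ).induce _)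
    ⟨ray (n - j), ray_mem_ballSet barredTree id (fun _ _ h => binaryTree_le_barredTree h)
      (Nat.sub_le n j)⟩

/-- The class `[S, u_{j + 1}]`, where `u_{j + 1}` is a vertex of `S` at height `j`. -/
def classS {Δ : ℕ} (hΔ : 4 ≤ Δ) (j : ℕ) : Gr Δ :=
  component graphS (graphS_bounded.mono hΔ) (j, 0)

/-- The class `[S̄, ū_{j + 1}]`, where `ū_{j + 1}` is a vertex of `S̄` at height `j`. -/
def classSBar {Δ : ℕ} (hΔ : 4 ≤ Δ) (j : ℕ) : Gr Δ :=
  component graphSBar (graphSBar_bounded.mono hΔ) (j, 0)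

/-- The measure `μ_S`. -/
noncomputable def muS {Δ : ℕ} (hΔ : 4 ≤ Δ) : ProbabilityMeasure (Gr Δ) :=
  geometricLaw (classS hΔ)

/-- The measure `μ_{S̄}`. -/
noncomputable def muSBar {Δ : ℕ} (hΔ : 4 ≤ Δ) : ProbabilityMeasure (Gr Δ) :=
  geometricLaw (classSBar hΔ)

end AdjacentBalls

open AdjacentBalls

/-! The ball of radius `n` about the first ancestor `x` of `Λ` contains `n + 1` full levels of `Λ`,
but only `n` levels of `Λ̄`, since crossing the edge `xy` costs one step (`mem_ballSet_join`). The
two sides have `2 ^ (n + 1) - 1` and `2 ^ n - 1` vertices, so their proportions tend to 2/3 and 1/3;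
about `y` the roles are exchanged. Moving the centre by one step thus doubles the weight of one side
relative to the other.

In a tree with `c` levels, most vertices are near the lowest level: `2 ^ (c - 1 - j)` of them,
asymptotically the fraction `2 ^ (-(j + 1))`, are at height `j`. Such a vertex is `c - 1 - j` steps
away from the first ancestor, which is the only vertex with neighbours outside the tree. For fixed
`j` and `s` and large `c`, its ball of radius `s` therefore does not see the rest of the graph, and
is the ball about a vertex of height `j` in `S` or `S̄` (`IsLimitFromBelow.component_ball_eq`). This
gives the limits of `[T_n, u_i]` and `[Λ̄_n, ū_i]` at once.

For the laws, the integral of a bounded continuous function is a sum over sides and heights; each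
term converges, and a geometric series dominates the sum (`tendsto_law`, applied in
`tendsto_law_joinedTree`).

The limits differ because the class of a leaf of `S`, a root of degree 1, has positive mass under
`μ_S` and mass zero under `μ_{S̄}` (`classSBar_ne_classS`). -/

namespace AdjacentBalls

/-! ### Balls of embedded graphs -/

/-- A graph embedding whose image is closed under neighbours at the vertices of positive height
maps the balls of radius at most the height of the centre onto balls. -/
theorem ballSet_embedding {I V : Type} {Z : SimpleGraph I} {X : SimpleGraph V} (g : Z ↪g X)
    (ht : I → ℕ) (hmono : ∀ i j, Z.Adj i j → ht i ≤ ht j + 1)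
    (hclosed : ∀ i v, 0 < ht i → X.Adj (g i) v → v ∈ Set.range g) (i : I) {r : ℕ}
    (hr : r ≤ ht i) : ballSet X (g i) r = g '' ballSet Z i r := by
  -- The induction also carries a lower bound on heights: a step lowers the height by at most one,
  -- so before radius `ht i` is reached every vertex has positive height and its neighbours stay in
  -- the image.
  suffices h : ballSet X (g i) r = g '' ballSet Z i r ∧ ∀ j ∈ ballSet Z i r, ht i ≤ ht j + r from
    h.1
  induction r with
  | zero =>
    refine ⟨?_, fun j hj => by rw [mem_ballSet_zero.1 hj]; simp⟩
    ext v
    rw [mem_ballSet_zero]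
    constructor
    · rintro rfl
      exact ⟨i, self_mem_ballSet _ _ _, rfl⟩
    · rintro ⟨j, hj, rfl⟩
      rw [mem_ballSet_zero.1 hj]
  | succ r ih =>
    obtain ⟨ih1, ih2⟩ := ih (by omega)
    refine ⟨?_, ?_⟩
    · ext v
      rw [mem_ballSet_succ, ih1]
      constructor
      · rintro (⟨j, hj, rfl⟩ | ⟨_, ⟨j, hj, rfl⟩, hadj⟩)
        · exact ⟨j, ballSet_mono _ _ (Nat.le_succ r) hj, rfl⟩
        · have := ih2 j hj
          obtain ⟨k, rfl⟩ := hclosed j v (by omega) hadj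
          exact ⟨k, mem_ballSet_succ.2 (Or.inr ⟨j, hj, g.map_adj_iff.1 hadj⟩), rfl⟩
      · rintro ⟨k, hk, rfl⟩
        rcases mem_ballSet_succ.1 hk with hk | ⟨j, hj, hadj⟩
        · exact Or.inl ⟨k, hk, rfl⟩
        · exact Or.inr ⟨g j, ⟨j, hj, rfl⟩, g.map_adj_iff.2 hadj⟩
    · intro k hk
      rcases mem_ballSet_succ.1 hk with hk | ⟨j, hj, hadj⟩
      · have := ih2 k hk
        omega
      · have := ih2 j hj
        have := hmono j k hadj
        omega

/-- The class of the rooted ball `(B_X(x, r), x)`. -/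
def ballClass {Δ : ℕ} {V : Type} [Countable V] (X : SimpleGraph V) (hX : BoundedDegree Δ X)
    (x : V) (r : ℕ) : Gr Δ :=
  Quotient.mk _
    { V := ballSet X x r
      countable := inferInstance
      graph := ball X x r
      root := ⟨x, self_mem_ballSet X x r⟩
      connected := ball_connected X x r
      bounded := hX.induce _ }

theorem ballClass_embedding {Δ : ℕ} {I V : Type} [Countable I] [Countable V] {Z : SimpleGraph I}
    {X : SimpleGraph V} (hZ : BoundedDegree Δ Z) (hX : BoundedDegree Δ X) (g : Z ↪g X) (i : I)
    (r : ℕ) (h : ballSet X (g i) r = g '' ballSet Z i r) :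
    ballClass Z hZ i r = ballClass X hX (g i) r := by
  let f : ballSet Z i r → ballSet X (g i) r := fun j =>
    ⟨g j.1, h ▸ Set.mem_image_of_mem g j.2⟩
  have hf : Function.Bijective f := by
    constructor
    · intro a b hab
      exact Subtype.ext (g.injective (congrArg Subtype.val hab))
    · rintro ⟨v, hv⟩
      obtain ⟨j, hj, rfl⟩ := h ▸ hv
      exact ⟨⟨j, hj⟩, rfl⟩
  refine Quotient.sound ⟨⟨Equiv.ofBijective f hf, ?_⟩, rfl⟩
  intro a b
  exact g.map_adj_iff (v := a.1) (w := b.1)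

theorem component_ball {Δ : ℕ} {V : Type} [Countable V] (X : SimpleGraph V)
    (hX : BoundedDegree Δ X) (x : V) (r : ℕ) :
    (component X hX x).ball r = ballClass X hX x r := by
  refine ballClass_embedding (hX.induce _) hX
    (SimpleGraph.Embedding.induce {y | X.Reachable x y}) ⟨x, .refl x⟩ r ?_
  -- A component is closed under neighbours at every vertex, so the height plays no role and may be
  -- taken constant.
  refine ballSet_embedding _ (fun _ => r) (fun _ _ _ => Nat.le_succ r) ?_ _ le_rfl
  rintro ⟨y, hy⟩ v - hadj
  have hadj' : X.Adj y v := hadj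
  exact ⟨⟨v, SimpleGraph.Reachable.trans hy hadj'.reachable⟩, rfl⟩

theorem component_ball_embedding {Δ : ℕ} {I V : Type} [Countable I] [Countable V]
    {Z : SimpleGraph I} {X : SimpleGraph V} (hZ : BoundedDegree Δ Z) (hX : BoundedDegree Δ X)
    (g : Z ↪g X) (ht : I → ℕ) (hmono : ∀ i j, Z.Adj i j → ht i ≤ ht j + 1)
    (hclosed : ∀ i v, 0 < ht i → X.Adj (g i) v → v ∈ Set.range g) (i : I) {r : ℕ}
    (hr : r ≤ ht i) : (component Z hZ i).ball r = (component X hX (g i)).ball r := by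
  rw [component_ball, component_ball]
  exact ballClass_embedding hZ hX g i r (ballSet_embedding g ht hmono hclosed i hr)

/-! ### Truncated trees in `S` and `S̄` -/

/-- The number with the given binary digits, the least significant one first. -/
def wordValue : List Bool → ℕ
  | [] => 0
  | b :: w => 2 * wordValue w + b.toNat

theorem wordValue_cons_div (b : Bool) (w : List Bool) : wordValue (b :: w) / 2 = wordValue w := by
  cases b <;> simp [wordValue] <;> omega

theorem wordValue_cons_mod (b : Bool) (w : List Bool) :
    wordValue (b :: w) % 2 = b.toNat := by
  cases b <;> simp [wordValue]

/-- The lengths must agree because a `false` at the end of a word is a leading zero of the number.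
-/
theorem wordValue_injective {u v : List Bool} (hl : u.length = v.length)
    (h : wordValue u = wordValue v) : u = v := by
  induction u generalizing v with
  | nil => exact (List.length_eq_zero_iff.1 hl.symm).symm
  | cons b u ih =>
    cases v with
    | nil => simp at hl
    | cons c v =>
      have h1 := congrArg (· / 2) h
      have h2 := congrArg (· % 2) h
      simp only [wordValue_cons_div, wordValue_cons_mod] at h1 h2
      rw [ih (by simpa using hl) h1]
      cases b <;> cases c <;> simp_all

/-- The vertex of `S` which corresponds to the word `w` in the perfect binary tree with `a`
levels. -/
def heightIndex (a : ℕ) (w : List Bool) : ℕ × ℕ := (a - 1 - w.length, wordValue w)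

theorem heightIndex_injective {a : ℕ} {u v : List Bool} (hu : u.length < a) (hv : v.length < a)
    (h : heightIndex a u = heightIndex a v) : u = v := by
  simp only [heightIndex, Prod.mk.injEq] at h
  exact wordValue_injective (by omega) h.2

theorem heightIndex_parent_iff {a : ℕ} {u v : List Bool} (hu : u.length < a) (hv : v.length < a) :
    heightIndex a u = ((heightIndex a v).1 + 1, (heightIndex a v).2 / 2) ↔ ∃ b, v = b :: u := by
  simp only [heightIndex, Prod.mk.injEq]
  constructor
  · rintro ⟨h1, h2⟩
    cases v with
    | nil => simp at h1; omega
    | cons b v =>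
      rw [wordValue_cons_div] at h2
      simp only [List.length_cons] at h1 hv
      exact ⟨b, by rw [wordValue_injective (by omega) h2]⟩
  · rintro ⟨b, rfl⟩
    simp only [List.length_cons] at hv ⊢
    exact ⟨by omega, (wordValue_cons_div b u).symm⟩

/-- Equal halves mean equal tails, so distinct words can differ only in their first letter.
Distinctness is required because the relation on the left is reflexive; in `graphSBar` the loops are
removed by `fromRel`. -/
theorem heightIndex_sibling_iff {a : ℕ} {u v : List Bool} (hu : u.length < a)
    (hv : v.length < a) (hne : u ≠ v) :
    ((heightIndex a u).1 = (heightIndex a v).1 ∧ (heightIndex a u).2 / 2 = (heightIndex a v).2 / 2)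
      ↔ ∃ b w, u = b :: w ∧ v = (!b) :: w := by
  simp only [heightIndex]
  constructor
  · rintro ⟨h1, h2⟩
    rcases u with _ | ⟨b, u⟩ <;> rcases v with _ | ⟨c, v⟩
    · exact absurd rfl hne
    · simp at h1 hv; omega
    · simp at h1 hu; omega
    · rw [wordValue_cons_div, wordValue_cons_div] at h2
      simp only [List.length_cons] at h1 hu hv
      obtain rfl := wordValue_injective (by omega) h2
      refine ⟨b, u, rfl, ?_⟩
      cases b <;> cases c <;> simp_all
  · rintro ⟨b, w, rfl, rfl⟩
    simp [wordValue_cons_div]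

/-- A vertex of which `heightIndex a w` is the parent. -/
theorem mem_range_heightIndex_of_child {a : ℕ} {w : List Bool} (hw : w.length < a) {q : ℕ × ℕ}
    (h : heightIndex a w = (q.1 + 1, q.2 / 2)) : ∃ v : List Bool, v.length < a ∧
      heightIndex a v = q := by
  obtain ⟨k, l⟩ := q
  simp only [heightIndex, Prod.mk.injEq] at h
  -- The new first letter is the last binary digit of `l`. The child still fits into the `a` levels
  -- because the height of `w` is `k + 1`, hence positive.
  refine ⟨decide (l % 2 = 1) :: w, by simp; omega, ?_⟩
  simp only [heightIndex, wordValue, List.length_cons, Prod.mk.injEq]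
  refine ⟨by omega, ?_⟩
  rcases Nat.mod_two_eq_zero_or_one l with h' | h' <;> simp [h'] <;> omega

theorem mem_range_heightIndex_of_parent {a : ℕ} {w : List Bool} (hw : w.length < a)
    (hpos : 0 < w.length) {q : ℕ × ℕ}
    (h : q = ((heightIndex a w).1 + 1, (heightIndex a w).2 / 2)) : ∃ v : List Bool, v.length < a ∧
      heightIndex a v = q := by
  cases w with
  | nil => simp at hpos
  | cons b w =>
    simp only [List.length_cons] at hw
    refine ⟨w, by omega, ?_⟩
    rw [h]
    exact (heightIndex_parent_iff (by omega) (by simpa using hw)).2 ⟨b, rfl⟩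

/-- A sibling is reached by going up to the common parent and down again. -/
theorem mem_range_heightIndex_of_sibling {a : ℕ} {w : List Bool} (hw : w.length < a)
    (hpos : 0 < w.length) {q : ℕ × ℕ} (h : (heightIndex a w).1 = q.1)
    (h' : (heightIndex a w).2 / 2 = q.2 / 2) : ∃ v : List Bool, v.length < a ∧
      heightIndex a v = q := by
  obtain ⟨v, hv, hvq⟩ := mem_range_heightIndex_of_parent hw hpos rfl
  refine mem_range_heightIndex_of_child hv (hvq.trans ?_)
  rw [h, h']

/-- The infinite graph `Y` on `ℕ × ℕ` is the limit of the balls of the tree `X`, seen from the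
lowest level. -/
structure IsLimitFromBelow (X : SimpleGraph (List Bool)) (Y : SimpleGraph (ℕ × ℕ)) : Prop where
  adj_iff : ∀ a u v, u.length < a → v.length < a →
    (Y.Adj (heightIndex a u) (heightIndex a v) ↔ X.Adj u v)
  closed : ∀ a w q, w.length < a → 0 < w.length → Y.Adj (heightIndex a w) q →
    ∃ v : List Bool, v.length < a ∧ heightIndex a v = q
  shift : ∀ c p q, Y.Adj (p.1, p.2 ^^^ (c >>> p.1)) (q.1, q.2 ^^^ (c >>> q.1)) ↔ Y.Adj p q
  length_le : ∀ u v, X.Adj u v → u.length ≤ v.length + 1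

/-- Passing to the parent halves the index, and half of `c >>> h` is `c >>> (h + 1)`. Hence flipping
the index at each height `h` by `c >>> h` commutes with taking parents; these flips are the
automorphisms of `S` and `S̄` required by the field `shift`. -/
theorem xor_shiftRight_eq_iff (c : ℕ) (p q : ℕ × ℕ) :
    ((q.1, q.2 ^^^ (c >>> q.1)) : ℕ × ℕ) =
      (p.1 + 1, (p.2 ^^^ (c >>> p.1)) / 2) ↔ q = (p.1 + 1, p.2 / 2) := by
  obtain ⟨h, m⟩ := p
  obtain ⟨k, l⟩ := q
  simp only [Prod.mk.injEq, Nat.xor_div_two, ← Nat.shiftRight_succ]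
  constructor
  · rintro ⟨rfl, h⟩
    exact ⟨rfl, Nat.xor_left_injective h⟩
  · rintro ⟨rfl, rfl⟩
    exact ⟨rfl, rfl⟩

theorem binaryTree_isLimitFromBelow : IsLimitFromBelow binaryTree graphS where
  adj_iff a u v hu hv := by
    simp only [graphS, binaryTree, SimpleGraph.fromRel_adj, heightIndex_parent_iff hu hv,
      heightIndex_parent_iff hv hu]
    refine and_congr (not_congr ⟨heightIndex_injective hu hv, fun h => by rw [h]⟩) or_comm
  closed a w q hw hpos h := by
    simp only [graphS, SimpleGraph.fromRel_adj] at h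
    rcases h.2 with h | h
    · exact mem_range_heightIndex_of_parent hw hpos h
    · exact mem_range_heightIndex_of_child hw h
  shift c p q := by
    simp only [graphS, SimpleGraph.fromRel_adj]
    rw [xor_shiftRight_eq_iff, xor_shiftRight_eq_iff]
    refine and_congr (not_congr ?_) Iff.rfl
    obtain ⟨h, m⟩ := p
    obtain ⟨k, l⟩ := q
    simp only [Prod.mk.injEq]
    constructor
    · rintro ⟨rfl, h⟩
      exact ⟨rfl, Nat.xor_left_injective h⟩
    · rintro ⟨rfl, rfl⟩
      exact ⟨rfl, rfl⟩
  length_le u v h := by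
    simp only [binaryTree, SimpleGraph.fromRel_adj] at h
    obtain ⟨-, ⟨b, rfl⟩ | ⟨b, rfl⟩⟩ := h <;> simp <;> omega

theorem barredTree_isLimitFromBelow : IsLimitFromBelow barredTree graphSBar where
  adj_iff a u v hu hv := by
    simp only [graphSBar, barredTree, SimpleGraph.fromRel_adj, heightIndex_parent_iff hu hv,
      heightIndex_parent_iff hv hu]
    have hne : heightIndex a u ≠ heightIndex a v ↔ u ≠ v :=
      not_congr ⟨heightIndex_injective hu hv, fun h => by rw [h]⟩
    rw [hne]
    refine and_congr_right fun h => ?_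
    rw [heightIndex_sibling_iff hu hv h, heightIndex_sibling_iff hv hu h.symm]
    simp only [or_assoc, or_comm, or_left_comm]
  closed a w q hw hpos h := by
    simp only [graphSBar, SimpleGraph.fromRel_adj] at h
    rcases h.2 with (h | ⟨h, h'⟩) | (h | ⟨h, h'⟩)
    · exact mem_range_heightIndex_of_parent hw hpos h
    · exact mem_range_heightIndex_of_sibling hw hpos h h'
    · exact mem_range_heightIndex_of_child hw h
    · exact mem_range_heightIndex_of_sibling hw hpos h.symm h'.symm
  shift c p q := by
    simp only [graphSBar, SimpleGraph.fromRel_adj]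
    rw [xor_shiftRight_eq_iff, xor_shiftRight_eq_iff]
    have key : ∀ p q : ℕ × ℕ, (p.1 = q.1 ∧ (p.2 ^^^ (c >>> p.1)) / 2 = (q.2 ^^^ (c >>> q.1)) / 2) ↔
        (p.1 = q.1 ∧ p.2 / 2 = q.2 / 2) := by
      rintro ⟨h, m⟩ ⟨k, l⟩
      refine and_congr_right fun h => ?_
      obtain rfl : _ = _ := h
      simp only [Nat.xor_div_two]
      exact Nat.xor_left_injective.eq_iff
    rw [key p q, key q p]
    refine and_congr (not_congr ?_) Iff.rfl
    obtain ⟨h, m⟩ := p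
    obtain ⟨k, l⟩ := q
    simp only [Prod.mk.injEq]
    constructor
    · rintro ⟨rfl, h⟩
      exact ⟨rfl, Nat.xor_left_injective h⟩
    · rintro ⟨rfl, rfl⟩
      exact ⟨rfl, rfl⟩
  length_le u v h := by
    simp only [barredTree, SimpleGraph.fromRel_adj] at h
    obtain ⟨-, (⟨b, rfl⟩ | ⟨b, w, rfl, rfl⟩) | ⟨b, rfl⟩ | ⟨b, w, rfl, rfl⟩⟩ := h <;> simp <;> omega

/-- The flips act transitively on the vertices of a given height, so the class of a rooted limit
graph depends only on the height of the root. -/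
theorem IsLimitFromBelow.component_eq {Δ : ℕ} {X : SimpleGraph (List Bool)}
    {Y : SimpleGraph (ℕ × ℕ)} (h : IsLimitFromBelow X Y) (hY : BoundedDegree Δ Y) (j m : ℕ) :
    component Y hY (j, m) = component Y hY (j, 0) := by
  -- With `c = m <<< j` the flip at height `j` is by `m` itself, which sends `(j, m)` to `(j, 0)`.
  let f : ℕ × ℕ → ℕ × ℕ := fun p => (p.1, p.2 ^^^ ((m <<< j) >>> p.1))
  have hf : Function.Involutive f := fun p => by simp [f]
  refine (component_eq_iff Y hY _ _).2 ⟨⟨hf.toPerm, fun {p q} => h.shift (m <<< j) p q⟩, ?_⟩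
  change f (j, m) = (j, 0)
  simp [f, Nat.shiftLeft_shiftRight]

/-- If the tree with `a` levels sits in a graph so that only its first ancestor has neighbours
outside, then the ball of radius `r` around a vertex at distance at least `r` from the first
ancestor is a ball of the limit graph. -/
theorem IsLimitFromBelow.component_ball_eq {Δ : ℕ} {X : SimpleGraph (List Bool)}
    {Y : SimpleGraph (ℕ × ℕ)} (h : IsLimitFromBelow X Y) (hY : BoundedDegree Δ Y) {V : Type}
    [Countable V] {G : SimpleGraph V} (hG : BoundedDegree Δ G) (a : ℕ)
    (g : X.induce {w | w.length < a} ↪g G)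
    (hclosed : ∀ i v, 0 < i.1.length → G.Adj (g i) v → v ∈ Set.range g)
    (w : {w : List Bool | w.length < a}) {r : ℕ} (hr : r ≤ w.1.length) :
    (component G hG (g w)).ball r = (component Y hY (a - 1 - w.1.length, 0)).ball r := by
  let f : X.induce {w | w.length < a} ↪g Y :=
    { toFun := fun w => heightIndex a w.1
      inj' := fun u v huv => Subtype.ext (heightIndex_injective u.2 v.2 huv)
      map_rel_iff' := fun {u v} => h.adj_iff a u.1 v.1 u.2 v.2 }
  have hf : ∀ i q, 0 < i.1.length → Y.Adj (f i) q → q ∈ Set.range f := fun i q hi hadj => by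
    obtain ⟨v, hv, rfl⟩ := h.closed a i.1 q i.2 hi hadj
    exact ⟨⟨v, hv⟩, rfl⟩
  have hmono : ∀ i j, (X.induce {w : List Bool | w.length < a}).Adj i j →
      i.1.length ≤ j.1.length + 1 := fun i j hij => h.length_le i.1 j.1 hij
  have hZ : BoundedDegree Δ (X.induce {w : List Bool | w.length < a}) := by
    intro v
    refine le_trans ?_ (hY (f v))
    rw [← f.injective.encard_image]
    refine Set.encard_le_encard ?_
    rintro _ ⟨w, hw, rfl⟩
    exact f.map_adj_iff.2 hw
  -- The truncated tree is embedded both in `G` and in `Y`. The height function here is the word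
  -- length, the distance from the first ancestor, which is the only exit in either graph; it runs
  -- opposite to the height in `S`.
  rw [← component_ball_embedding hZ hG g (fun i => i.1.length) hmono hclosed w hr,
    component_ball_embedding hZ hY f (fun i => i.1.length) hmono hf w hr]
  exact congrArg (Gr.ball · r) (h.component_eq hY _ _)

/-! ### Weak convergence of laws -/

theorem dist_le_of_ball_eq {Δ : ℕ} {g h : Gr Δ} {r : ℕ} (hr : g.ball r = h.ball r) :
    dist g h ≤ (2⁻¹ : ℝ) ^ r := by
  change Gr.rho g h ≤ _
  unfold Gr.rho
  split_ifs with hgh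
  · positivity
  · exact pow_le_pow_of_le_one (by norm_num) (by norm_num) (le_csSup (Gr.bddAbove hgh) hr)

theorem integral_law {Δ : ℕ} {V : Type} [Fintype V] [Nonempty V] (X : SimpleGraph V)
    (hX : BoundedDegree Δ X) (F : BoundedContinuousFunction (Gr Δ) ℝ) :
    ∫ g, F g ∂(law X hX : Measure (Gr Δ)) =
      (∑ x : V, F (component X hX x)) / (Nat.card V : ℝ) := by
  change ∫ g, F g ∂((Nat.card V : ℝ≥0∞)⁻¹ •
    Measure.sum fun x : V => Measure.dirac (component X hX x)) = _
  rw [integral_smul_measure, Measure.sum_fintype, integral_finsetSum_measure]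
  · simp only [integral_dirac, ENNReal.toReal_inv, ENNReal.toReal_natCast, smul_eq_mul]
    rw [div_eq_inv_mul]
  · intro x _
    exact F.integrable _

/-- Weak convergence of laws of finite graphs whose vertices are divided into countably many
levels, such that the proportion of every level converges and the neighbourhoods of the vertices of
each level converge uniformly. -/
theorem tendsto_law {Δ : ℕ} {K : Type} [DecidableEq K] {V : ℕ → Type} [∀ n, Finite (V n)]
    [∀ n, Nonempty (V n)] (X : ∀ n, SimpleGraph (V n)) (hX : ∀ n, BoundedDegree Δ (X n))
    (lev : ∀ n, V n → K) (p : K → Gr Δ) (q bound : K → ℝ) (hsum : Summable bound)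
    (hlim : ∀ k, Tendsto (fun n => (Nat.card {x // lev n x = k} : ℝ) / Nat.card (V n)) atTop
      (𝓝 (q k)))
    (hbound : ∀ᶠ n in atTop, ∀ k, (Nat.card {x // lev n x = k} : ℝ) / Nat.card (V n) ≤ bound k)
    (hp : ∀ k s, ∀ᶠ n in atTop, ∀ x, lev n x = k →
      (component (X n) (hX n) x).ball s = (p k).ball s)
    (μ : ProbabilityMeasure (Gr Δ))
    (hμ : ∀ F : BoundedContinuousFunction (Gr Δ) ℝ,
      HasSum (fun k => q k * F (p k)) (∫ g, F g ∂(μ : Measure (Gr Δ)))) :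
    Tendsto (fun n => law (X n) (hX n)) atTop (𝓝 μ) := by
  have inst : ∀ n, Fintype (V n) := fun n => Fintype.ofFinite _
  rw [ProbabilityMeasure.tendsto_iff_forall_integral_tendsto]
  intro F
  rw [← (hμ F).tsum_eq]
  -- `c n k` is the proportion of level `k`, and `S n k` is the contribution of that level to the
  -- integral of `F`.
  let c : ℕ → K → ℝ := fun n k => (Nat.card {x // lev n x = k} : ℝ) / Nat.card (V n)
  let S : ℕ → K → ℝ := fun n k =>
    (∑ x with lev n x = k, F (component (X n) (hX n) x)) / Nat.card (V n)
  have hcard : ∀ n k, (Nat.card {x // lev n x = k} : ℝ) =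
      ((Finset.univ.filter fun x => lev n x = k).card : ℝ) := fun n k => by
    rw [Nat.card_eq_fintype_card, Fintype.card_subtype]
  have hS : ∀ n, ∫ g, F g ∂(law (X n) (hX n) : Measure (Gr Δ)) = ∑' k, S n k := fun n => by
    rw [integral_law, tsum_eq_sum (s := Finset.univ.image (lev n)), ← Finset.sum_div,
      Finset.sum_fiberwise_of_maps_to (fun x _ => Finset.mem_image_of_mem _ (Finset.mem_univ x))]
    intro k hk
    have : (Finset.univ.filter fun x => lev n x = k) = ∅ := by
      ext x
      simp only [Finset.mem_filter, Finset.mem_univ, true_and, Finset.notMem_empty, iff_false]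
      rintro rfl
      exact hk (Finset.mem_image_of_mem _ (Finset.mem_univ x))
    simp [S, this]
  simp_rw [hS]
  -- The contribution of level `k` is at most its proportion times the norm of `F`, which provides
  -- the summable bound.
  refine tendsto_tsum_of_dominated_convergence (hsum.mul_right ‖F‖) ?_ ?_
  · intro k
    have h1 : Tendsto (fun n => c n k * F (p k)) atTop (𝓝 (q k * F (p k))) :=
      (hlim k).mul_const _
    -- Continuity of `F` at the single point `p k` suffices: for large `n` all classes on level `k`
    -- are uniformly close to it, and the proportion of the level is at most 1.
    have h2 : Tendsto (fun n => S n k - c n k * F (p k)) atTop (𝓝 0) := by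
      rw [Metric.tendsto_atTop']
      intro ε hε
      obtain ⟨δ, hδ, hF⟩ := Metric.continuous_iff.1 F.continuous (p k) (ε / 2) (by positivity)
      obtain ⟨s, hs⟩ := exists_pow_lt_of_lt_one hδ (show (2⁻¹ : ℝ) < 1 by norm_num)
      obtain ⟨N, hN⟩ := eventually_atTop.1 (hp k s)
      refine ⟨N, fun n hn => ?_⟩
      have hV : (0 : ℝ) < Nat.card (V n) := by exact_mod_cast Nat.card_pos
      have hle : (Nat.card {x // lev n x = k} : ℝ) ≤ Nat.card (V n) := by
        exact_mod_cast Nat.card_le_card_of_injective _ Subtype.val_injective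
      have heq : S n k - c n k * F (p k) =
          (∑ x with lev n x = k, (F (component (X n) (hX n) x) - F (p k))) / Nat.card (V n) := by
        simp only [S, c, hcard, Finset.sum_sub_distrib, Finset.sum_const, nsmul_eq_mul]
        ring
      rw [dist_zero_right, heq, norm_div, Real.norm_natCast, div_lt_iff₀ hV]
      calc ‖∑ x with lev n x = k, (F (component (X n) (hX n) x) - F (p k))‖
          ≤ ∑ x with lev n x = k, ε / 2 := by
            refine norm_sum_le_of_le _ fun x hx => ?_
            rw [← dist_eq_norm]
            refine (hF _ ((dist_le_of_ball_eq (hN n hn.le x ?_)).trans_lt hs)).le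
            simpa using hx
        _ = Nat.card {x // lev n x = k} * (ε / 2) := by
            rw [hcard, Finset.sum_const, nsmul_eq_mul]
        _ < ε * Nat.card (V n) := by nlinarith
    simpa using h2.add h1
  · filter_upwards [hbound] with n hn k
    refine le_trans ?_ (mul_le_mul_of_nonneg_right (hn k) (norm_nonneg F))
    simp only [S]
    rw [norm_div, Real.norm_natCast, div_mul_eq_mul_div, hcard]
    gcongr
    refine (norm_sum_le_of_le _ fun x _ => F.norm_coe_le_norm _).trans ?_
    rw [Finset.sum_const, nsmul_eq_mul]

theorem hasSum_integral_geometricLaw {Δ : ℕ} (g : ℕ → Gr Δ)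
    (F : BoundedContinuousFunction (Gr Δ) ℝ) :
    HasSum (fun j => (2⁻¹ : ℝ) ^ (j + 1) * F (g j))
      (∫ x, F x ∂(geometricLaw g : Measure (Gr Δ))) := by
  have h := hasSum_integral_measure (F.integrable (geometricLaw g : Measure (Gr Δ)))
  simpa [integral_smul_measure] using! h

theorem tendsto_of_ball_eq {Δ : ℕ} {g : ℕ → Gr Δ} {h : Gr Δ}
    (H : ∀ s, ∀ᶠ n in atTop, (g n).ball s = h.ball s) : Tendsto g atTop (𝓝 h) := by
  rw [Metric.tendsto_atTop']
  intro ε hε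
  obtain ⟨s, hs⟩ := exists_pow_lt_of_lt_one hε (show (2⁻¹ : ℝ) < 1 by norm_num)
  obtain ⟨N, hN⟩ := eventually_atTop.1 (H s)
  exact ⟨N, fun n hn => (dist_le_of_ball_eq (hN n hn.le)).trans_lt hs⟩

/-! ### Counting words -/

theorem card_words_length_eq (k : ℕ) : Nat.card {w : List Bool // w.length = k} = 2 ^ k := by
  change Nat.card (List.Vector Bool k) = _
  rw [Nat.card_eq_fintype_card, card_vector, Fintype.card_bool]

theorem card_words_length_lt (a : ℕ) : Nat.card {w : List Bool // w.length < a} = 2 ^ a - 1 := by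
  change Nat.card ↥{w : List Bool | w.length < a} = _
  rw [Nat.card_coe_set_eq]
  induction a with
  | zero => simp
  | succ a ih =>
    have h : {w : List Bool | w.length < a + 1} =
        {w | w.length < a} ∪ {w | w.length = a} := by
      ext w
      simp only [Set.mem_ofPred_eq, Set.mem_union]
      omega
    have h2 : {w : List Bool | w.length = a}.ncard = 2 ^ a := by
      rw [← Nat.card_coe_set_eq]
      exact card_words_length_eq a
    rw [h, Set.ncard_union_eq _ (List.finite_length_lt _ _) (List.finite_length_eq _ _), ih, h2]
    · have := Nat.one_le_two_pow (n := a)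
      omega
    · rw [Set.disjoint_left]
      intro w hw hw'
      simp only [Set.mem_ofPred_eq] at hw hw'
      omega

theorem card_words_height_eq (a j : ℕ) :
    Nat.card {w : {w : List Bool // w.length < a} // a - 1 - w.1.length = j} =
      if j < a then 2 ^ (a - 1 - j) else 0 := by
  split_ifs with h
  · rw [← card_words_length_eq]
    refine Nat.card_congr ⟨fun w => ⟨w.1.1, ?_⟩, fun w => ⟨⟨w.1, ?_⟩, ?_⟩, fun _ => rfl,
      fun _ => rfl⟩
    · have := w.2
      have := w.1.2
      omega
    · have := w.2
      omega
    · have := w.2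
      simp only
      omega
  · rw [Nat.card_eq_zero]
    refine Or.inl ⟨fun w => ?_⟩
    have := w.2
    have := w.1.2
    omega

/-! ### Balls of joined trees -/

theorem join_adj_inl {V W : Type} {X : SimpleGraph V} {a : V} {Y : SimpleGraph W} {b : W}
    {u v : V} : (join X a Y b).Adj (.inl u) (.inl v) ↔ X.Adj u v := by
  simp [join, SimpleGraph.edge_adj]

theorem join_adj_inr {V W : Type} {X : SimpleGraph V} {a : V} {Y : SimpleGraph W} {b : W}
    {u v : W} : (join X a Y b).Adj (.inr u) (.inr v) ↔ Y.Adj u v := by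
  simp [join, SimpleGraph.edge_adj]

theorem join_adj_inl_inr {V W : Type} {X : SimpleGraph V} {a : V} {Y : SimpleGraph W} {b : W}
    {u : V} {v : W} : (join X a Y b).Adj (.inl u) (.inr v) ↔ u = a ∧ v = b := by
  simp [join, SimpleGraph.edge_adj]

theorem join_adj_inr_inl {V W : Type} {X : SimpleGraph V} {a : V} {Y : SimpleGraph W} {b : W}
    {u : W} {v : V} : (join X a Y b).Adj (.inr u) (.inl v) ↔ v = a ∧ u = b := by
  rw [SimpleGraph.adj_comm, join_adj_inl_inr]

/-- Exchanging the two sides of a joined graph. -/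
def joinComm {V W : Type} (X : SimpleGraph V) (a : V) (Y : SimpleGraph W) (b : W) :
    join X a Y b ≃g join Y b X a where
  toEquiv := Equiv.sumComm V W
  map_rel_iff' := by
    rintro (u | u) (v | v)
    · exact join_adj_inr.trans join_adj_inl.symm
    · exact join_adj_inr_inl.trans (and_comm.trans join_adj_inl_inr.symm)
    · exact join_adj_inl_inr.trans (and_comm.trans join_adj_inr_inl.symm)
    · exact join_adj_inl.trans join_adj_inr.symm

theorem binaryTree_adj_cons (b : Bool) (w : List Bool) : binaryTree.Adj w (b :: w) := by
  simp [binaryTree]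

/-- An edge changes the length of a word by at most one, so bars do not shorten the way from the
first ancestor, and the tree edges reach each word in as many steps as it has letters. -/
theorem mem_ballSet_nil {X : SimpleGraph (List Bool)} (hX : binaryTree ≤ X)
    (hl : ∀ u v, X.Adj u v → u.length ≤ v.length + 1) (n : ℕ) (w : List Bool) :
    w ∈ ballSet X [] n ↔ w.length < n + 1 := by
  induction n generalizing w with
  | zero => simp [mem_ballSet_zero]
  | succ n ih =>
    rw [mem_ballSet_succ, ih]
    constructor
    · rintro (h | ⟨u, hu, hadj⟩)
      · omega
      · have := (ih u).1 hu
        have := hl w u hadj.symm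
        omega
    · intro h
      rcases w with _ | ⟨b, w⟩
      · exact Or.inl (by simp)
      · exact Or.inr ⟨w, (ih w).2 (by simpa using h), hX (binaryTree_adj_cons b w)⟩

/-- The far side is entered one step late through its first ancestor, so it has one level fewer than
the near side. This off-by-one is the source of the unequal weights. The two sides are proved
together because the induction crosses the joining edge. -/
theorem mem_ballSet_join {X Y : SimpleGraph (List Bool)} (hX : binaryTree ≤ X)
    (hlX : ∀ u v, X.Adj u v → u.length ≤ v.length + 1) (hY : binaryTree ≤ Y)
    (hlY : ∀ u v, Y.Adj u v → u.length ≤ v.length + 1) (n : ℕ) :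
    (∀ w, .inl w ∈ ballSet (join X [] Y []) (.inl []) n ↔ w.length < n + 1) ∧
      ∀ w, .inr w ∈ ballSet (join X [] Y []) (.inl []) n ↔ w.length < n := by
  induction n with
  | zero => simp [mem_ballSet_zero]
  | succ n ih =>
    obtain ⟨ihl, ihr⟩ := ih
    refine ⟨fun w => ?_, fun w => ?_⟩
    · rw [mem_ballSet_succ, ihl]
      constructor
      · rintro (h | ⟨u | u, hu, hadj⟩)
        · omega
        · have := (ihl u).1 hu
          have := hlX w u (join_adj_inl.1 hadj).symm
          omega
        · rw [(join_adj_inr_inl.1 hadj).1]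
          simp
      · intro h
        rcases w with _ | ⟨b, w⟩
        · exact Or.inl (by simp)
        · exact Or.inr ⟨.inl w, (ihl w).2 (by simpa using h),
            join_adj_inl.2 (hX (binaryTree_adj_cons b w))⟩
    · rw [mem_ballSet_succ, ihr]
      constructor
      · rintro (h | ⟨u | u, hu, hadj⟩)
        · omega
        · rw [(join_adj_inl_inr.1 hadj).2]
          simp
        · have := (ihr u).1 hu
          have := hlY w u (join_adj_inr.1 hadj).symm
          omega
      · intro h
        rcases w with _ | ⟨b, w⟩
        · exact Or.inr ⟨.inl [], self_mem_ballSet _ _ _, join_adj_inl_inr.2 ⟨rfl, rfl⟩⟩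
        · exact Or.inr ⟨.inr w, (ihr w).2 (by simpa using h),
            join_adj_inr.2 (hY (binaryTree_adj_cons b w))⟩

theorem mem_ballSet_join_inr {V W : Type} (X : SimpleGraph V) (a : V) (Y : SimpleGraph W) (b : W)
    (n : ℕ) (v : V ⊕ W) :
    v ∈ ballSet (join X a Y b) (.inr b) n ↔ v.swap ∈ ballSet (join Y b X a) (.inl b) n := by
  -- An isomorphism has full range, so a constant height works again.
  have h := ballSet_embedding (joinComm X a Y b).toEmbedding (fun _ => n)
    (fun _ _ _ => Nat.le_succ n) (fun _ v _ _ => ⟨_, (joinComm X a Y b).apply_symm_apply v⟩)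
    (.inr b) le_rfl
  change ballSet (join Y b X a) (.inl b) n = Sum.swap '' _ at h
  rw [h, Sum.swap_leftInverse.injective.mem_set_image]

/-! ### Balls of a truncated join -/

section Truncated

variable {A : Set (List Bool ⊕ List Bool)} {a b : ℕ}

theorem card_truncatedJoin (hl : ∀ w, .inl w ∈ A ↔ w.length < a)
    (hr : ∀ w, .inr w ∈ A ↔ w.length < b) : Nat.card A = (2 ^ a - 1) + (2 ^ b - 1) := by
  have f1 : Finite {w : List Bool // w.length < a} := List.finite_length_lt _ _
  have f2 : Finite {w : List Bool // w.length < b} := List.finite_length_lt _ _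
  rw [← card_words_length_lt, ← card_words_length_lt, ← Nat.card_sum]
  refine (Nat.card_congr (Equiv.ofBijective
    (Sum.elim (fun w => ⟨.inl w.1, (hl _).2 w.2⟩) (fun w => ⟨.inr w.1, (hr _).2 w.2⟩)) ⟨?_, ?_⟩)).symm
  · rintro (⟨u, hu⟩ | ⟨u, hu⟩) (⟨v, hv⟩ | ⟨v, hv⟩) huv <;> simp_all
  · rintro ⟨w | w, hw⟩
    · exact ⟨.inl ⟨w, (hl w).1 hw⟩, rfl⟩
    · exact ⟨.inr ⟨w, (hr w).1 hw⟩, rfl⟩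

/-- The side and the height of a vertex of a truncated join. -/
def sideHeight (a b : ℕ) : List Bool ⊕ List Bool → ℕ ⊕ ℕ :=
  Sum.map (fun w => a - 1 - w.length) (fun w => b - 1 - w.length)

theorem card_sideHeight_inl (hl : ∀ w, .inl w ∈ A ↔ w.length < a) (j : ℕ) :
    Nat.card {x : A // sideHeight a b x = .inl j} = if j < a then 2 ^ (a - 1 - j) else 0 := by
  rw [← card_words_height_eq]
  refine (Nat.card_congr (Equiv.ofBijective
    (fun w => ⟨⟨.inl w.1.1, (hl _).2 w.1.2⟩, congrArg Sum.inl w.2⟩) ⟨?_, ?_⟩)).symm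
  · intro u v huv
    exact Subtype.ext (Subtype.ext (Sum.inl_injective
      (congrArg (fun x : {x : A // sideHeight a b x = .inl j} => x.1.1) huv)))
  · rintro ⟨⟨w | w, hw⟩, h⟩
    · exact ⟨⟨⟨w, (hl w).1 hw⟩, Sum.inl_injective h⟩, rfl⟩
    · simp [sideHeight] at h

theorem card_sideHeight_inr (hr : ∀ w, .inr w ∈ A ↔ w.length < b) (j : ℕ) :
    Nat.card {x : A // sideHeight a b x = .inr j} = if j < b then 2 ^ (b - 1 - j) else 0 := by
  rw [← card_words_height_eq]
  refine (Nat.card_congr (Equiv.ofBijective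
    (fun w => ⟨⟨.inr w.1.1, (hr _).2 w.1.2⟩, congrArg Sum.inr w.2⟩) ⟨?_, ?_⟩)).symm
  · intro u v huv
    exact Subtype.ext (Subtype.ext (Sum.inr_injective
      (congrArg (fun x : {x : A // sideHeight a b x = .inr j} => x.1.1) huv)))
  · rintro ⟨⟨w | w, hw⟩, h⟩
    · simp [sideHeight] at h
    · exact ⟨⟨⟨w, (hr w).1 hw⟩, Sum.inr_injective h⟩, rfl⟩

/-- The joining edge ends on this side at the empty word, so nothing leaves the side at positive
word length. The other tree `X'` is arbitrary, so that both `regularTree` and `joinedTree` are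
covered. -/
theorem IsLimitFromBelow.component_ball_eq_inl {Δ : ℕ} {X X' : SimpleGraph (List Bool)}
    {Y : SimpleGraph (ℕ × ℕ)} (h : IsLimitFromBelow X Y) (hY : BoundedDegree Δ Y)
    (hl : ∀ w, .inl w ∈ A ↔ w.length < a)
    (hG : BoundedDegree Δ ((join X [] X' []).induce A)) {w : List Bool} (hw : .inl w ∈ A) {r : ℕ}
    (hr : r ≤ w.length) :
    (component ((join X [] X' []).induce A) hG ⟨.inl w, hw⟩).ball r =
      (component Y hY (a - 1 - w.length, 0)).ball r := by
  refine h.component_ball_eq hY hG a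
    { toFun := fun w => ⟨.inl w.1, (hl _).2 w.2⟩
      inj' := fun u v huv => Subtype.ext (by simpa using huv)
      map_rel_iff' := fun {u v} => join_adj_inl } ?_ ⟨w, (hl w).1 hw⟩ hr
  rintro i ⟨v | v, hv⟩ hi hadj
  · exact ⟨⟨v, (hl v).1 hv⟩, rfl⟩
  · have : i.1 = [] := (join_adj_inl_inr.1 hadj).1
    simp [this] at hi

theorem IsLimitFromBelow.component_ball_eq_inr {Δ : ℕ} {X X' : SimpleGraph (List Bool)}
    {Y : SimpleGraph (ℕ × ℕ)} (h : IsLimitFromBelow X Y) (hY : BoundedDegree Δ Y)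
    (hl : ∀ w, .inr w ∈ A ↔ w.length < a)
    (hG : BoundedDegree Δ ((join X' [] X []).induce A)) {w : List Bool} (hw : .inr w ∈ A) {r : ℕ}
    (hr : r ≤ w.length) :
    (component ((join X' [] X []).induce A) hG ⟨.inr w, hw⟩).ball r =
      (component Y hY (a - 1 - w.length, 0)).ball r := by
  refine h.component_ball_eq hY hG a
    { toFun := fun w => ⟨.inr w.1, (hl _).2 w.2⟩
      inj' := fun u v huv => Subtype.ext (by simpa using huv)
      map_rel_iff' := fun {u v} => join_adj_inr } ?_ ⟨w, (hl w).1 hw⟩ hr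
  rintro i ⟨v | v, hv⟩ hi hadj
  · have : i.1 = [] := (join_adj_inr_inl.1 hadj).2
    simp [this] at hi
  · exact ⟨⟨v, (hl v).1 hv⟩, rfl⟩

end Truncated

/-! ### The limits of the rooted graphs -/

theorem tendsto_classT {Δ : ℕ} (hΔ : 4 ≤ Δ) (j : ℕ) :
    Tendsto (fun n => classT hΔ n j) atTop (𝓝 (classS hΔ j)) := by
  refine tendsto_of_ball_eq fun s => ?_
  filter_upwards [eventually_ge_atTop (j + s)] with n hn
  -- The left half of `T_n` is a binary tree with `n + 1` levels, and `u_{j + 1}` lies in it at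
  -- height `j`, at distance `n - j ≥ s` from the joining edge.
  have hl := (mem_ballSet_join le_rfl binaryTree_isLimitFromBelow.length_le le_rfl
    binaryTree_isLimitFromBelow.length_le n).1
  refine (binaryTree_isLimitFromBelow.component_ball_eq_inl (graphS_bounded.mono hΔ) hl
    ((regularTree_bounded.mono hΔ).induce _) (w := ray (n - j)) _ ?_).trans ?_
  · simp [ray]; omega
  · have : n + 1 - 1 - (ray (n - j)).length = j := by simp [ray]; omega
    rw [this]
    rfl

theorem tendsto_classBarred {Δ : ℕ} (hΔ : 4 ≤ Δ) (j : ℕ) :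
    Tendsto (fun n => classBarred hΔ n j) atTop (𝓝 (classSBar hΔ j)) := by
  refine tendsto_of_ball_eq fun s => ?_
  filter_upwards [eventually_ge_atTop (j + s)] with n hn
  have hl := mem_ballSet_nil binaryTree_le_barredTree barredTree_isLimitFromBelow.length_le n
  refine (barredTree_isLimitFromBelow.component_ball_eq (graphSBar_bounded.mono hΔ)
    ((barredTree_bounded.mono hΔ).induce (ballSet barredTree [] n)) (n + 1)
    { toFun := fun w => ⟨w.1, (hl _).2 w.2⟩
      inj' := fun u v huv => Subtype.ext (by simpa using huv)
      map_rel_iff' := Iff.rfl } ?_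
    ⟨ray (n - j), by simp [ray]⟩ (r := s) ?_).trans ?_
  -- The truncated tree is the whole of `Λ̄_n`, so there is no exit at all.
  · rintro i ⟨v, hv⟩ - -
    exact ⟨⟨v, (hl v).1 hv⟩, rfl⟩
  · simp [ray]; omega
  · have : n + 1 - 1 - (ray (n - j)).length = j := by simp [ray]; omega
    simp only [this]
    rfl

/-! ### The limits of the laws -/

theorem tendsto_law_joinedTree {Δ : ℕ} (hΔ : 4 ≤ Δ) (A : ℕ → Set (List Bool ⊕ List Bool))
    [∀ n, Finite (A n)] [∀ n, Nonempty (A n)] (a b : ℕ → ℕ)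
    (hl : ∀ n w, .inl w ∈ A n ↔ w.length < a n) (hr : ∀ n w, .inr w ∈ A n ↔ w.length < b n)
    (ha : Tendsto a atTop atTop) (hb : Tendsto b atTop atTop) {α β : ℝ≥0∞} (hα : α ≠ ∞)
    (hβ : β ≠ ∞)
    (hlα : Tendsto (fun n => (2 : ℝ) ^ a n / (2 ^ a n + 2 ^ b n - 2)) atTop (𝓝 α.toReal))
    (hlβ : Tendsto (fun n => (2 : ℝ) ^ b n / (2 ^ a n + 2 ^ b n - 2)) atTop (𝓝 β.toReal))
    (μ : ProbabilityMeasure (Gr Δ)) (hμ : (μ : Measure (Gr Δ)) =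
      α • (muS hΔ : Measure (Gr Δ)) + β • (muSBar hΔ : Measure (Gr Δ))) :
    Tendsto (fun n => law (joinedTree.induce (A n)) ((joinedTree_bounded.mono hΔ).induce (A n)))
      atTop (𝓝 μ) := by
  have hcard : ∀ n, (Nat.card (A n) : ℝ) = 2 ^ a n + 2 ^ b n - 2 := fun n => by
    rw [card_truncatedJoin (hl n) (hr n), Nat.cast_add, Nat.cast_sub Nat.one_le_two_pow,
      Nat.cast_sub Nat.one_le_two_pow]
    push_cast
    ring
  -- For `j < c`, a level has `2 ^ (c - 1 - j) = 2 ^ c * 2 ^ (-(j + 1))` vertices: the limiting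
  -- weight is exact relative to `2 ^ c`, and for `j ≥ c`, where the level is empty, it remains an
  -- upper bound.
  have hcount : ∀ (c j : ℕ) (D : ℝ), 0 ≤ D →
      ((if j < c then 2 ^ (c - 1 - j) else 0 : ℕ) : ℝ) / D ≤ 2 ^ c / D * 2⁻¹ ^ (j + 1) ∧
      (j < c → ((if j < c then 2 ^ (c - 1 - j) else 0 : ℕ) : ℝ) / D =
        2 ^ c / D * 2⁻¹ ^ (j + 1)) := by
    intro c j D hD
    by_cases h : j < c
    · obtain ⟨k, rfl⟩ := Nat.exists_eq_add_of_lt h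
      have : ((if j < j + k + 1 then 2 ^ (j + k + 1 - 1 - j) else 0 : ℕ) : ℝ) / D =
          2 ^ (j + k + 1) / D * 2⁻¹ ^ (j + 1) := by
        rw [if_pos h, show j + k + 1 - 1 - j = k by omega, show j + k + 1 = k + (j + 1) by omega,
          pow_add (2 : ℝ) k, inv_pow]
        push_cast
        field_simp
      exact ⟨this.le, fun _ => this⟩
    · refine ⟨?_, fun h' => absurd h' h⟩
      rw [if_neg h]
      simp only [Nat.cast_zero, zero_div]
      positivity
  have hlim : ∀ (c : ℕ → ℕ) (γ : ℝ) (j : ℕ), Tendsto c atTop atTop →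
      Tendsto (fun n => (2 : ℝ) ^ c n / Nat.card (A n)) atTop (𝓝 γ) →
      Tendsto (fun n => ((if j < c n then 2 ^ (c n - 1 - j) else 0 : ℕ) : ℝ) / Nat.card (A n))
        atTop (𝓝 (γ * 2⁻¹ ^ (j + 1))) := by
    intro c γ j hc hγ
    refine (hγ.mul_const _).congr' ?_
    filter_upwards [hc.eventually_gt_atTop j] with n hn
    exact ((hcount (c n) j _ (Nat.cast_nonneg _)).2 hn).symm
  simp_rw [← hcard] at hlα hlβ
  have hgeom : ∀ γ : ℝ, Summable fun j : ℕ => γ * (2⁻¹ : ℝ) ^ (j + 1) := fun γ =>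
    ((summable_nat_add_iff 1).2 (summable_geometric_of_lt_one (by norm_num) (by norm_num))).mul_left
      γ
  refine tendsto_law (fun n => joinedTree.induce (A n))
    (fun n => (joinedTree_bounded.mono hΔ).induce (A n)) (fun n x => sideHeight (a n) (b n) x)
    (Sum.elim (classS hΔ) (classSBar hΔ))
    (Sum.elim (fun j => α.toReal * 2⁻¹ ^ (j + 1)) (fun j => β.toReal * 2⁻¹ ^ (j + 1)))
    -- The ratios `2 ^ a n / |A n|` and `2 ^ b n / |A n|` converge, so they are eventually at most
    -- their limits plus 1.
    (Sum.elim (fun j => (α.toReal + 1) * 2⁻¹ ^ (j + 1)) (fun j => (β.toReal + 1) * 2⁻¹ ^ (j + 1)))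
    (Summable.sum _ (hgeom _) (hgeom _)) ?_ ?_ ?_ μ ?_
  · rintro (j | j)
    · simp_rw [fun n => card_sideHeight_inl (b := b n) (hl n) j]
      exact hlim a _ j ha hlα
    · simp_rw [fun n => card_sideHeight_inr (a := a n) (hr n) j]
      exact hlim b _ j hb hlβ
  · filter_upwards [hlα.eventually_le_const (lt_add_one _),
      hlβ.eventually_le_const (lt_add_one _)] with n h1 h2
    rintro (j | j)
    · rw [card_sideHeight_inl (hl n) j]
      exact (hcount _ _ _ (Nat.cast_nonneg _)).1.trans
        (mul_le_mul_of_nonneg_right h1 (by positivity))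
    · rw [card_sideHeight_inr (hr n) j]
      exact (hcount _ _ _ (Nat.cast_nonneg _)).1.trans
        (mul_le_mul_of_nonneg_right h2 (by positivity))
  · rintro (j | j) s
    -- A vertex at height `j` has word length `a n - 1 - j`, which is now at least `s`.
    · filter_upwards [ha.eventually_ge_atTop (j + s + 1)] with n hn
      rintro ⟨w | w, hw⟩ hx
      · have hj : a n - 1 - w.length = j := Sum.inl_injective hx
        have hw' := (hl n w).1 hw
        refine (binaryTree_isLimitFromBelow.component_ball_eq_inl (graphS_bounded.mono hΔ) (hl n)
          _ hw (by omega)).trans ?_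
        rw [hj]
        rfl
      · simp [sideHeight] at hx
    · filter_upwards [hb.eventually_ge_atTop (j + s + 1)] with n hn
      rintro ⟨w | w, hw⟩ hx
      · simp [sideHeight] at hx
      · have hj : b n - 1 - w.length = j := Sum.inr_injective hx
        have hw' := (hr n w).1 hw
        refine (barredTree_isLimitFromBelow.component_ball_eq_inr (graphSBar_bounded.mono hΔ)
          (hr n) _ hw (by omega)).trans ?_
        rw [hj]
        rfl
  · intro F
    rw [hμ, integral_add_measure ((F.integrable _).smul_measure hα)
      ((F.integrable _).smul_measure hβ), integral_smul_measure, integral_smul_measure]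
    refine HasSum.sum ?_ ?_
    · simpa [Function.comp_def, mul_assoc] using!
        (hasSum_integral_geometricLaw (classS hΔ) F).mul_left α.toReal
    · simpa [Function.comp_def, mul_assoc] using!
        (hasSum_integral_geometricLaw (classSBar hΔ) F).mul_left β.toReal

/-- The denominator is the number of vertices of a ball, `2 ^ n * (3 - 2 * 2 ^ (-n))`. The case `k =
1` gives the share 2/3 of the side of the centre, and `k = 0` the share 1/3 of the other side. -/
theorem tendsto_two_pow_div (k : ℕ) :
    Tendsto (fun n : ℕ => (2 : ℝ) ^ (n + k) / (2 ^ (n + 1) + 2 ^ n - 2)) atTop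
      (𝓝 (2 ^ k / 3)) := by
  have h : Tendsto (fun n : ℕ => (2 : ℝ) ^ k / (3 - 2 * 2⁻¹ ^ n)) atTop
      (𝓝 (2 ^ k / (3 - 2 * 0))) :=
    tendsto_const_nhds.div (tendsto_const_nhds.sub
      ((tendsto_pow_atTop_nhds_zero_of_lt_one (by norm_num) (by norm_num)).const_mul 2))
      (by norm_num)
  simp only [mul_zero, sub_zero] at h
  refine h.congr fun n => ?_
  have h2 : (2 : ℝ) ^ n ≠ 0 := by positivity
  rw [← mul_div_mul_left _ (3 - 2 * (2⁻¹ : ℝ) ^ n) h2, pow_add, inv_pow]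
  congr 1
  field_simp
  ring

/-! ### The limits are different -/

/-- A leaf of `S` has its parent as only neighbour, while every `(j, 0)` in `S̄` has two: its
sibling `(j, 1)` and its parent `(j + 1, 0)`. An isomorphism of the rooted graphs would send both to
the same vertex. -/
theorem classSBar_ne_classS {Δ : ℕ} (hΔ : 4 ≤ Δ) (j : ℕ) : classSBar hΔ j ≠ classS hΔ 0 := by
  intro h
  obtain ⟨φ, hφ⟩ : ∃ φ : graphSBar.induce {y | graphSBar.Reachable (j, 0) y} ≃g
      graphS.induce {y | graphS.Reachable (0, 0) y},
      φ ⟨(j, 0), .refl _⟩ = ⟨(0, 0), .refl _⟩ := Quotient.exact h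
  have h1 : graphSBar.Adj (j, 0) (j, 1) := by simp [graphSBar]
  have h2 : graphSBar.Adj (j, 0) (j + 1, 0) := by simp [graphSBar]
  have key : ∀ q (hq : graphSBar.Adj (j, 0) q), (φ ⟨q, hq.reachable⟩).1 = (1, 0) := by
    intro q hq
    have h3 : graphS.Adj (φ ⟨(j, 0), .refl _⟩).1 (φ ⟨q, hq.reachable⟩).1 :=
      φ.map_adj_iff (v := ⟨(j, 0), .refl _⟩) (w := ⟨q, hq.reachable⟩) |>.2 hq
    rw [hφ] at h3
    simp only [graphS, SimpleGraph.fromRel_adj] at h3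
    rcases h3.2 with h3 | h3
    · exact h3
    · simp at h3
  have := φ.injective (Subtype.ext ((key _ h1).trans (key _ h2).symm))
  simp at this

theorem muSBar_singleton {Δ : ℕ} (hΔ : 4 ≤ Δ) :
    (muSBar hΔ : Measure (Gr Δ)) {classS hΔ 0} = 0 := by
  change Measure.sum _ _ = _
  rw [Measure.sum_apply _ (measurableSet_singleton _), ENNReal.tsum_eq_zero]
  intro j
  rw [Measure.smul_apply, Measure.dirac_apply' _ (measurableSet_singleton _)]
  simp [classSBar_ne_classS hΔ j]

theorem muS_singleton_ne_zero {Δ : ℕ} (hΔ : 4 ≤ Δ) :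
    (muS hΔ : Measure (Gr Δ)) {classS hΔ 0} ≠ 0 := by
  change Measure.sum _ _ ≠ _
  rw [Measure.sum_apply _ (measurableSet_singleton _), Ne, ENNReal.tsum_eq_zero, not_forall]
  refine ⟨0, ?_⟩
  rw [Measure.smul_apply, Measure.dirac_apply' _ (measurableSet_singleton _)]
  simp

theorem isProbabilityMeasure_mix {Ω : Type*} [MeasurableSpace Ω] (P Q : ProbabilityMeasure Ω)
    {α β : ℝ≥0∞} (h : α + β = 1) :
    IsProbabilityMeasure (α • (P : Measure Ω) + β • (Q : Measure Ω)) :=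
  ⟨by simp [h]⟩

end AdjacentBalls

open AdjacentBalls

theorem mainTheorem12 (Δ : ℕ) (hΔ : 4 ≤ Δ) :
    (∀ j : ℕ, Tendsto (fun n => classT hΔ n j) atTop (𝓝 (classS hΔ j))) ∧
    (∀ j : ℕ, Tendsto (fun n => classBarred hΔ n j) atTop (𝓝 (classSBar hΔ j))) ∧
    ∃ μ ν : ProbabilityMeasure (Gr Δ),
      (μ : Measure (Gr Δ)) = (2 / 3 : ℝ≥0∞) • (muS hΔ : Measure (Gr Δ)) +
        (1 / 3 : ℝ≥0∞) • (muSBar hΔ : Measure (Gr Δ)) ∧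
      (ν : Measure (Gr Δ)) = (1 / 3 : ℝ≥0∞) • (muS hΔ : Measure (Gr Δ)) +
        (2 / 3 : ℝ≥0∞) • (muSBar hΔ : Measure (Gr Δ)) ∧
      Tendsto (fun n => ballLaw joinedTree (joinedTree_bounded.mono hΔ) (Sum.inl []) n)
        atTop (𝓝 μ) ∧
      Tendsto (fun n => ballLaw joinedTree (joinedTree_bounded.mono hΔ) (Sum.inr []) n)
        atTop (𝓝 ν) ∧
      μ ≠ ν := by
  have h3 : (3 : ℝ≥0∞) ≠ 0 := by norm_num
  have hsum : (2 / 3 : ℝ≥0∞) + 1 / 3 = 1 := by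
    rw [ENNReal.div_add_div_same, show (2 : ℝ≥0∞) + 1 = 3 by norm_num]
    exact ENNReal.div_self h3 (by norm_num)
  have hsum' : (1 / 3 : ℝ≥0∞) + 2 / 3 = 1 := (add_comm _ _).trans hsum
  have hα : (2 / 3 : ℝ≥0∞) ≠ ∞ := ENNReal.div_ne_top (by norm_num) h3
  have hβ : (1 / 3 : ℝ≥0∞) ≠ ∞ := ENNReal.div_ne_top (by norm_num) h3
  have hfin : ∀ x n, Finite (ballSet joinedTree x n) := fun x n =>
    joinedTree_bounded.finite_ballSet x n
  have hlim2 := tendsto_two_pow_div 1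
  have hlim1 := tendsto_two_pow_div 0
  have h2' : (2 / 3 : ℝ≥0∞).toReal = 2 ^ 1 / 3 := by simp [ENNReal.toReal_div]
  have h1' : (1 / 3 : ℝ≥0∞).toReal = 2 ^ 0 / 3 := by simp
  rw [← h2'] at hlim2
  rw [← h1'] at hlim1
  refine ⟨tendsto_classT hΔ, tendsto_classBarred hΔ,
    ⟨_, isProbabilityMeasure_mix (muS hΔ) (muSBar hΔ) hsum⟩,
    ⟨_, isProbabilityMeasure_mix (muS hΔ) (muSBar hΔ) hsum'⟩, rfl, rfl, ?_, ?_, ?_⟩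
  · have hmem := mem_ballSet_join le_rfl binaryTree_isLimitFromBelow.length_le
      binaryTree_le_barredTree barredTree_isLimitFromBelow.length_le
    exact tendsto_law_joinedTree hΔ (fun n => ballSet joinedTree (.inl []) n) (fun n => n + 1)
      (fun n => n) (fun n => (hmem n).1) (fun n => (hmem n).2) (tendsto_add_atTop_nat 1) tendsto_id
      hα hβ hlim2 hlim1 _ rfl
  -- About `y` the barred side is the near one; the ball is computed in the mirrored join and
  -- carried back by `mem_ballSet_join_inr`.
  · have hmem := mem_ballSet_join binaryTree_le_barredTree barredTree_isLimitFromBelow.length_le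
      le_rfl binaryTree_isLimitFromBelow.length_le
    refine tendsto_law_joinedTree hΔ (fun n => ballSet joinedTree (.inr []) n) (fun n => n)
      (fun n => n + 1) (fun n w => (mem_ballSet_join_inr _ _ _ _ n _).trans ((hmem n).2 w))
      (fun n w => (mem_ballSet_join_inr _ _ _ _ n _).trans ((hmem n).1 w)) tendsto_id
      (tendsto_add_atTop_nat 1) hβ hα ?_ ?_ _ rfl
    · simpa only [add_comm ((2 : ℝ) ^ (_ + 1)), add_zero] using hlim1
    · simpa only [add_comm ((2 : ℝ) ^ (_ + 1))] using hlim2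
  -- On the class of a leaf of `S` the two limits take the values 2/3 and 1/3 of the same finite,
  -- nonzero mass.
  · intro h
    have h' := congrArg (fun P : ProbabilityMeasure (Gr Δ) =>
      (P : Measure (Gr Δ)) {classS hΔ 0}) h
    simp only [ProbabilityMeasure.coe_mk, Measure.add_apply, Measure.smul_apply,
      muSBar_singleton, smul_eq_mul, mul_zero, add_zero] at h'
    rw [ENNReal.mul_left_inj (muS_singleton_ne_zero hΔ) (measure_ne_top _ _)] at h'
    have := congrArg ENNReal.toReal h'
    rw [h2', h1'] at this
    norm_num at this
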